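/- An inversion sequence of length $n\ge 0$ is an integer sequence $e=(e_1,\dots,e_n)$ with $0\le e_j\le j-1$ for all $j$. It contains a word $w$ of length $k$ as a pattern if there are indices $i_1<\dots<i_k$ such that replacing, for each $i$, all copies of the $i$-th smallest of the distinct values among $e_{i_1},\dots,e_{i_k}$ by $i-1$ turns $e_{i_1}\cdots e_{i_k}$ into $w$; otherwise it avoids $w$. Let $\mathcal{IS}_n(102,000)$ be the set of inversion sequences of length $n$ that avoid both $102$ and $000$. For $e\in\mathcal{IS}_n(102,000)$ let $\mathrm{dist}(e)$ be the number of distinct values of $e$, and for $n\ge1$ let $\mathrm{rank}(e)=p-\max(e)-1$, where $p$ is the position of the first descent, i.e. $e_1\le e_2\le\dots\le e_p>e_{p+1}$ with the convention $e_{n+1}=-1$; the empty sequence has $\mathrm{dist}=\mathrm{rank}=0$. Let $$E=E(x,y,z)=\sum_{n,m,t\ge0}\bigl|\{e\in\mathcal{IS}_n(102,000):\mathrm{dist}(e)=m,\ \mathrm{rank}(e)=t\}\bigr|\,x^ny^mz^t\in\mathbb{Q}[[x,y,z]].$$ (a) The power series $E$ is algebraic over $\mathbb{Q}(x,y,z)$,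 and its minimal polynomial is the following polynomial of degree $4$ in $T$, that is, the polynomial is irreducible in $\mathbb{Q}[x,y,z][T]$, it vanishes at $T=E$, and it is the product of its leading coefficient with the monic minimal polynomial of $E$ over $\mathbb{Q}(x,y,z)$: $$\begin{aligned} 1&-\bigl(1-2yx(1-x)z+y(1-x)^2(1-z)\bigr)T\\ &+y\bigl(2x^2z^2+x(1-x)(2z^2-6z+3)+yx^2(1-x)^2z^2+(1-x)^2(1-z)-yx(1-x)^3(1-z)\bigr)T^2\\ &+yx\bigl(2yx^2(1-x)z^3+xz(1-z)(4-z)-2yx(1-x)^2z(1-z)-2(1-x)(1-z)^2\bigr)T^3\\ &+yx^2\bigl(yx^2z^4-yx(1-x)z^2(1-z)+(1-z)^3\bigr)T^4 . \end{aligned}$$ (b) For each $n$ only finitely many coefficients of $x^ny^mz^t$ in $E$ are non-zero, so that $E(x,1,1)$ is defined, and $E(x,1,1)=F(x):=\sum_{n\ge0}|\mathcal{IS}_n(102,000)|\,x^n$. Substituting $y=z=1$ in the polynomial of (a) gives $$1-(1-2x+2x^2)T+x(-1+4x-2x^2+x^3)T^2+2x^3(1-x)T^3+x^4T^4,$$ the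 polynomial conjectured by Testart; it vanishes at $T=F$ and is the minimal polynomial of $F$ over $\mathbb{Q}(x)$, in the same sense as in (a): it is irreducible in $\mathbb{Q}[x][T]$ and is the product of its leading coefficient with the monic minimal polynomial of $F$ over $\mathbb{Q}(x)$. -/

import Mathlib

namespace InvSeq

open Polynomial

/-- Inversion sequences of length `n`. The entry `e_j`, `1 ≤ j ≤ n`, is `e ⟨j - 1, _⟩`, so
that the condition `0 ≤ e_j ≤ j - 1` reads `e i ≤ i` for `i : Fin n`. -/
def invSeqs (n : ℕ) : Finset (Fin n → ℕ) :=
  Fintype.piFinset fun i => Finset.range ((i : ℕ) + 1)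

/-- The reduction of a word: each letter is replaced by the number of distinct smaller letters,
that is, all copies of the `i`-th smallest letter are replaced by `i - 1`. -/
def reduction {k : ℕ} (u : Fin k → ℕ) : Fin k → ℕ :=
  fun i => ((Finset.univ.image u).filter (· < u i)).card

/-- `e` contains the pattern `w`: some subsequence of `e` has reduction `w`. -/
def Contains {n k : ℕ} (e : Fin n → ℕ) (w : Fin k → ℕ) : Prop :=
  ∃ f : Fin k → Fin n, (∀ i j, i < j → f i < f j) ∧ reduction (e ∘ f) = w

instance {n k : ℕ} (e : Fin n → ℕ) (w : Fin k → ℕ) : Decidable (Contains e w) := by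
  unfold Contains
  infer_instance

/-- The `(102, 000)`-avoiding inversion sequences of length `n`. -/
def avoiders (n : ℕ) : Finset (Fin n → ℕ) :=
  (invSeqs n).filter fun e => ¬ Contains e ![1, 0, 2] ∧ ¬ Contains e ![0, 0, 0]

/-- The number of distinct elements. -/
def dist {n : ℕ} (e : Fin n → ℕ) : ℕ :=
  (Finset.univ.image e).card

/-- The entry at the 1-based position `j`, with the value `-1` outside `1, …, n`. -/
def entry {n : ℕ} (e : Fin n → ℕ) (j : ℕ) : ℤ :=
  if h : 1 ≤ j ∧ j ≤ n then (e ⟨j - 1, by omega⟩ : ℤ) else -1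

/-- The (1-based) position of the first descent, where `e_{n+1} = -1`. For `n ≥ 1` the set
below contains `n`. -/
noncomputable def firstDescent {n : ℕ} (e : Fin n → ℕ) : ℕ :=
  sInf {p : ℕ | 1 ≤ p ∧ p ≤ n ∧ entry e (p + 1) < entry e p}

/-- The rank: (position of the first descent) - (largest entry) - 1, and `0` for the empty
sequence. -/
noncomputable def rank {n : ℕ} (e : Fin n → ℕ) : ℤ :=
  if n = 0 then 0 else (firstDescent e : ℤ) - (Finset.univ.sup e : ℕ) - 1

/-- The number of `(102, 000)`-avoiding inversion sequences of length `n` with `m` distinct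
elements and rank `t`. -/
noncomputable def count (n m t : ℕ) : ℕ :=
  ((avoiders n).filter fun e => dist e = m ∧ rank e = (t : ℤ)).card

/-- The generating function `E(x, y, z) = ∑ count n m t * x ^ n * y ^ m * z ^ t`, where `x`, `y`,
`z` are the variables with index `0`, `1`, `2`. -/
noncomputable def E : MvPowerSeries (Fin 3) ℚ :=
  fun d => (count (d 0) (d 1) (d 2) : ℚ)

/-- The generating function of all `(102, 000)`-avoiding inversion sequences by length. -/
noncomputable def F : PowerSeries ℚ :=
  PowerSeries.mk fun n => ((avoiders n).card : ℚ)

/-- The polynomial in `T` (here `Polynomial.X`) over a commutative ring with parameters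
`x`, `y`, `z`. -/
noncomputable def quartic {S : Type*} [CommRing S] (x y z : S) : S[X] :=
  1 - C (1 - 2 * y * x * (1 - x) * z + y * (1 - x) ^ 2 * (1 - z)) * X
    + C (y * (2 * x ^ 2 * z ^ 2 + x * (1 - x) * (2 * z ^ 2 - 6 * z + 3)
        + y * x ^ 2 * (1 - x) ^ 2 * z ^ 2 + (1 - x) ^ 2 * (1 - z)
        - y * x * (1 - x) ^ 3 * (1 - z))) * X ^ 2
    + C (y * x * (2 * y * x ^ 2 * (1 - x) * z ^ 3 + x * z * (1 - z) * (4 - z)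
        - 2 * y * x * (1 - x) ^ 2 * z * (1 - z) - 2 * (1 - x) * (1 - z) ^ 2)) * X ^ 3
    + C (y * x ^ 2 * (y * x ^ 2 * z ^ 4 - y * x * (1 - x) * z ^ 2 * (1 - z)
        + (1 - z) ^ 3)) * X ^ 4

/-- The quartic over `ℚ[x, y, z]`. -/
noncomputable def quarticE : (MvPolynomial (Fin 3) ℚ)[X] :=
  quartic (MvPolynomial.X 0) (MvPolynomial.X 1) (MvPolynomial.X 2)

/-- Testart's polynomial with parameter `x`. -/
noncomputable def testart {S : Type*} [CommRing S] (x : S) : S[X] :=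
  1 - C (1 - 2 * x + 2 * x ^ 2) * X + C (x * (-1 + 4 * x - 2 * x ^ 2 + x ^ 3)) * X ^ 2
    + C (2 * x ^ 3 * (1 - x)) * X ^ 3 + C (x ^ 4) * X ^ 4

/-- The substitution `y = z = 1`, as a ring homomorphism `ℚ[x, y, z] → ℚ[x]`. -/
noncomputable def substOne : MvPolynomial (Fin 3) ℚ →+* ℚ[X] :=
  (MvPolynomial.aeval ![(X : ℚ[X]), 1, 1] : MvPolynomial (Fin 3) ℚ →ₐ[ℚ] ℚ[X])

instance : IsDomain (MvPowerSeries (Fin 3) ℚ) :=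
  NoZeroDivisors.to_isDomain _

instance : FaithfulSMul (MvPolynomial (Fin 3) ℚ) (MvPowerSeries (Fin 3) ℚ) := by
  rw [faithfulSMul_iff_algebraMap_injective]
  intro p q h
  simpa [MvPowerSeries.algebraMap_apply'] using h

instance : FaithfulSMul ℚ[X] (PowerSeries ℚ) := by
  rw [faithfulSMul_iff_algebraMap_injective]
  intro p q h
  simpa [PowerSeries.algebraMap_apply'] using h

/-- `P` is a minimal polynomial, with coefficients in the domain `R` (a polynomial ring below), of
the element `a` of the domain `A ⊇ R`: it is irreducible in `R[T]` (so its coefficients have no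
common factor), and up to its leading coefficient it is the monic minimal polynomial of `a` over
`Frac R`, where `a` is read in the field `Frac A ⊇ Frac R`. -/
def IsMinimalPolynomial {R A : Type*} [CommRing R] [IsDomain R] [CommRing A] [IsDomain A]
    [Algebra R A] [FaithfulSMul R A] (P : R[X]) (a : A) : Prop :=
  letI : Algebra (FractionRing R) (FractionRing A) := FractionRing.liftAlgebra R (FractionRing A)
  Irreducible P ∧
    P.map (algebraMap R (FractionRing R)) =
      C (algebraMap R (FractionRing R) P.leadingCoeff) *
        minpoly (FractionRing R) (algebraMap A (FractionRing A) a)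

end InvSeq

/-! Delete all copies of the largest value M from a nonempty avoider. By 000-avoidance there are one
or two, and what remains is an avoider. Conversely, copies of an M exceeding every entry may be
inserted exactly when at least M entries precede the first copy and the old entries before the last
copy are weakly increasing, because the maximum can only play the 2 of a pattern 102
(`isAvoider_insert_iff`, `isAvoider_insert_insert_iff`). With h the maximum plus one and p the
length of the longest weakly increasing prefix, the choices are h ≤ M ≤ i ≤ p, or h ≤ M ≤ i ≤ j ≤ p.
Their numbers depend only on the rank s = p - h: for r ≤ s, rank r arises from s+1-r single
insertions and C(s+1-r, 2) separated pairs, and for 1 ≤ r ≤ s+1 from s+1-(r-1) adjacent pairs.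

Hence the series E_r of the avoiders of rank r satisfy E_r = [r=0] + xy Σ_k (k+1) E_{r+k} + x²y
([r>0] Σ_k (k+1) E_{r-1+k} + Σ_k C(k+1,2) E_{r+k}), which determines them by recursion on the
length. The solution is geometric, E_r = A q^r: the sums become 1/(1-q)² and q/(1-q)³, all cases r >
0 collapse to one equation for q, and r = 0 gives A. In terms of V = q/(1-q) the equation for q is a
polynomial fixed-point equation, solvable X-adically. Then E = A/(1-zq), and eliminating q from two
polynomial relations between E and q leaves the quartic (`quartic_of_relations`).

The quartic has constant term 1, so irreducibility can be checked after any specialisation that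
keeps its degree: y = z = 1, then x = 1, then modulo 2, where it is T⁴+T+1. Gauss's lemma identifies
it with the minimal polynomial. -/

namespace InvSeq

/-! ### Power series: the geometric solution of the rank system and the elimination of q -/

section Algebra

open PowerSeries

variable {S : Type*} [CommRing S]

theorem eq_zero_of_forall_X_pow_dvd {a : S⟦X⟧} (h : ∀ n, (X : S⟦X⟧) ^ n ∣ a) : a = 0 := by
  ext n
  exact (X_pow_dvd_iff.1 (h (n + 1))) n (Nat.lt_succ_self n)

/-- A contraction for the `X`-adic metric has a fixed point. -/
theorem exists_fixedPoint (Φ : S⟦X⟧ → S⟦X⟧)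
    (h : ∀ (n : ℕ) (a b : S⟦X⟧), X ^ n ∣ a - b → X ^ (n + 1) ∣ Φ a - Φ b) : ∃ a, Φ a = a := by
  have h1 : ∀ k j, (X : S⟦X⟧) ^ k ∣ Φ^[k + j] 0 - Φ^[k] 0 := by
    intro k
    induction k with
    | zero => simp
    | succ k ih =>
      intro j
      have e : k + 1 + j = (k + j) + 1 := by ring
      rw [e, Function.iterate_succ_apply', Function.iterate_succ_apply']
      exact h _ _ _ (ih j)
  set a : S⟦X⟧ := PowerSeries.mk fun n => coeff n (Φ^[n + 1] 0) with ha
  have h2 : ∀ n, (X : S⟦X⟧) ^ n ∣ a - Φ^[n] 0 := by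
    intro n
    rw [X_pow_dvd_iff]
    intro m hm
    obtain ⟨j, rfl⟩ := Nat.exists_eq_add_of_lt hm
    have := X_pow_dvd_iff.1 (h1 (m + 1) j) m (Nat.lt_succ_self m)
    rw [map_sub, sub_eq_zero] at this ⊢
    rw [ha, coeff_mk, ← this]
    congr 2
    ring
  refine ⟨a, ?_⟩
  rw [← sub_eq_zero]
  apply eq_zero_of_forall_X_pow_dvd
  intro n
  have h3 := h n _ _ (h2 n)
  have h4 := h2 (n + 1)
  rw [Function.iterate_succ_apply'] at h4
  have h5 := dvd_sub h3 h4
  rw [sub_sub_sub_cancel_right] at h5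
  exact (pow_dvd_pow _ (Nat.le_succ n)).trans h5

theorem exists_kernel_root (y : S) : ∃ V : S⟦X⟧,
    V = X * C y * (1 + V) ^ 2 * (X * (1 + V) ^ 2 + (1 - X) * V) := by
  obtain ⟨V, hV⟩ := exists_fixedPoint
    -- A polynomial expression P satisfies a - b ∣ P(a) - P(b), and the outer factor X gains one
    -- more power: a contraction.
    (fun V : S⟦X⟧ => X * C y * (1 + V) ^ 2 * (X * (1 + V) ^ 2 + (1 - X) * V)) (by
      intro n a b hab
      have hd : a - b ∣ C y * (1 + a) ^ 2 * (X * (1 + a) ^ 2 + (1 - X) * a) -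
          C y * (1 + b) ^ 2 * (X * (1 + b) ^ 2 + (1 - X) * b) := by
        have hp := Polynomial.sub_dvd_eval_sub a b
          (Polynomial.C (C y) * (1 + Polynomial.X) ^ 2 *
            (Polynomial.C X * (1 + Polynomial.X) ^ 2 + (1 - Polynomial.C X) * Polynomial.X) :
            Polynomial S⟦X⟧)
        simpa using hp
      have := mul_dvd_mul (dvd_refl (X : S⟦X⟧)) (hab.trans hd)
      rw [← pow_succ'] at this
      convert this using 1
      ring)
  exact ⟨V, hV.symm⟩

theorem one_sub_mul_sum_pow {R : Type*} [CommRing R] (q : R) (N : ℕ) :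
    (1 - q) * ∑ k ∈ Finset.range N, q ^ k = 1 - q ^ N := mul_neg_geom_sum q N

theorem one_sub_mul_sum_succ_mul_pow {R : Type*} [CommRing R] (q : R) (N : ℕ) :
    (1 - q) * ∑ k ∈ Finset.range N, ((k : R) + 1) * q ^ k =
      ∑ k ∈ Finset.range N, q ^ k - N * q ^ N := by
  induction N with
  | zero => simp
  | succ N ih =>
    rw [Finset.sum_range_succ, Finset.sum_range_succ, mul_add, ih]
    push_cast
    ring

theorem one_sub_mul_sum_choose_mul_pow {R : Type*} [CommRing R] (q : R) (N : ℕ) :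
    (1 - q) * ∑ k ∈ Finset.range N, ((k + 1).choose 2 : R) * q ^ k =
      ∑ k ∈ Finset.range N, ((k : R) + 1) * q ^ k - ∑ k ∈ Finset.range N, q ^ k
        - (N.choose 2 : R) * q ^ N := by
  induction N with
  | zero => simp
  | succ N ih =>
    rw [Finset.sum_range_succ, Finset.sum_range_succ, Finset.sum_range_succ, mul_add, ih]
    have : ((N + 1).choose 2 : R) = N + N.choose 2 := by
      rw [Nat.choose_succ_succ' N 1]; simp
    rw [this]
    ring

/-- Elimination of `q` from the two relations, by a Bézout resultant. -/
theorem quartic_of_relations {R : Type*} [CommRing R] [IsDomain R] (x y z E q : R) (hx : x ≠ 0)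
    (hα : x * E * z + (1 - x) ≠ 0)
    (h1 : x * E * (1 - z * q) * (1 - q) = x + (1 - x) * q * (1 - q))
    (h2 : x ^ 2 * y * E * (1 - z * q) = q * (1 - q) ^ 2) :
    1 - (1 - 2 * y * x * (1 - x) * z + y * (1 - x) ^ 2 * (1 - z)) * E
    + (y * (2 * x ^ 2 * z ^ 2 + x * (1 - x) * (2 * z ^ 2 - 6 * z + 3)
        + y * x ^ 2 * (1 - x) ^ 2 * z ^ 2 + (1 - x) ^ 2 * (1 - z)
        - y * x * (1 - x) ^ 3 * (1 - z))) * E ^ 2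
    + (y * x * (2 * y * x ^ 2 * (1 - x) * z ^ 3 + x * z * (1 - z) * (4 - z)
        - 2 * y * x * (1 - x) ^ 2 * z * (1 - z) - 2 * (1 - x) * (1 - z) ^ 2)) * E ^ 3
    + (y * x ^ 2 * (y * x ^ 2 * z ^ 4 - y * x * (1 - x) * z ^ 2 * (1 - z)
        + (1 - z) ^ 3)) * E ^ 4 = 0 := by
  obtain ⟨α, hα'⟩ : ∃ α, α = x * E * z + (1 - x) := ⟨_, rfl⟩
  obtain ⟨β, hβ⟩ : ∃ β, β = -x * E * (1 + z) - (1 - x) := ⟨_, rfl⟩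
  obtain ⟨γ, hγ⟩ : ∃ γ, γ = x * E - x := ⟨_, rfl⟩
  obtain ⟨b, hb⟩ : ∃ b, b = -2 * α - β := ⟨_, rfl⟩
  obtain ⟨c, hc⟩ : ∃ c, c = α * (1 + x ^ 2 * y * z * E) - γ := ⟨_, rfl⟩
  obtain ⟨d, hd⟩ : ∃ d, d = -(α * (x ^ 2 * y * E)) := ⟨_, rfl⟩
  have hf : α * q ^ 2 + β * q + γ = 0 := by
    rw [hα', hβ, hγ]; linear_combination h1
  -- The second relation is cubic in q; multiplied by α and reduced by the quadratic `hf`, it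
  -- becomes a second quadratic.
  have hh : b * q ^ 2 + c * q + d = 0 := by
    rw [hb, hc, hd]; linear_combination -α * h2 - q * hf
  have hlin : (α * c - β * b) * q + (α * d - γ * b) = 0 := by
    linear_combination α * hh - b * hf
  -- Eliminating the constant terms of the two quadratics leaves q times this expression; at q = 0
  -- both γ and d vanish.
  have hlin' : (α * d - γ * b) * q + (β * d - γ * c) = 0 := by
    by_cases hq : q = 0
    · subst hq
      have hγ0 : γ = 0 := by simpa using hf
      have hd0 : d = 0 := by simpa using hh
      simp [hγ0, hd0]
    · apply mul_left_cancel₀ hq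
      linear_combination d * hf - γ * hh
  have hres : (α * d - γ * b) ^ 2 - (α * c - β * b) * (β * d - γ * c) = 0 := by
    linear_combination (α * d - γ * b) * hlin - (α * c - β * b) * hlin'
  rw [← hα'] at hα
  -- The resultant equals -x³α times the quartic, which is why x and α must be nonzero.
  apply mul_left_cancel₀ (mul_ne_zero (pow_ne_zero 3 hx) hα)
  rw [mul_zero, ← neg_eq_zero, ← hres, hb, hc, hd, hα', hβ, hγ]
  ring

/-- The data of a solution of the kernel equation, with the derived series `q` and `A`. -/
structure KernelSolution (y : S) where
  V : S⟦X⟧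
  q : S⟦X⟧
  A : S⟦X⟧
  q_mul : q * (1 + V) = V
  X_dvd : X ∣ q
  A_eq : A = 1 + A * (X * C y * (1 + V) ^ 2 * (1 + X * V))
  q_eq : q = q * (X * C y * (1 + V) ^ 2 * (1 + X * V)) + X ^ 2 * C y * (1 + V) ^ 2
  X_mul_A : X * A = X * (1 + V) + (1 - X) * q
  V_eq : X ^ 2 * C y * A * (1 + V) ^ 3 = V

theorem nonempty_kernelSolution (y : S) : Nonempty (KernelSolution y) := by
  obtain ⟨V, hV⟩ := exists_kernel_root y
  -- Here q is V/(1+V), with V replaced by the right side of its equation so that 1+V cancels. The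
  -- visible factor X of q then lets A be written as (1+V) + (1-X) q/X.
  refine ⟨⟨V, X * C y * (1 + V) * (X * (1 + V) ^ 2 + (1 - X) * V),
    (1 + V) * (1 + (1 - X) * C y * (X * (1 + V) ^ 2 + (1 - X) * V)), ?_, ?_, ?_, ?_, ?_, ?_⟩⟩
  · linear_combination -hV
  · exact ⟨C y * (1 + V) * (X * (1 + V) ^ 2 + (1 - X) * V), by ring⟩
  · linear_combination (1 + C y * (1 + V) * (1 - X) * (1 + X * V)) * hV
  · linear_combination X * C y * (1 + V) * (1 + X * V) * hV
  · ring
  · linear_combination (-(1 - X) * X * C y * (1 + V) ^ 2 - 1) * hV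

namespace KernelSolution

variable {y : S} (K : KernelSolution y)

theorem one_sub_mul : (1 - K.q) * (1 + K.V) = 1 := by
  linear_combination -K.q_mul

theorem X_pow_dvd_q_pow (N : ℕ) : X ^ N ∣ K.q ^ N := pow_dvd_pow_of_dvd K.X_dvd N

theorem X_pow_dvd_sub_sum (N : ℕ) :
    X ^ N ∣ (1 + K.V) ^ 2 - ∑ k ∈ Finset.range N, ((k : S⟦X⟧) + 1) * K.q ^ k := by
  -- The tail of Σ (k+1) q^k from k = N on is q^N (1/(1-q)² + N/(1-q)).
  refine (K.X_pow_dvd_q_pow N).trans ⟨(1 + K.V) ^ 2 + N * (1 + K.V), ?_⟩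
  have h := K.one_sub_mul
  have h0 := one_sub_mul_sum_pow K.q N
  have h1 := one_sub_mul_sum_succ_mul_pow K.q N
  generalize ∑ k ∈ Finset.range N, ((k : S⟦X⟧) + 1) * K.q ^ k = a at *
  generalize ∑ k ∈ Finset.range N, K.q ^ k = b at *
  linear_combination (-(1 + K.V)) * h1 - (1 + K.V) ^ 2 * h0 + (a + (1 + K.V) * b) * h

theorem X_pow_dvd_sub_sum_choose (N : ℕ) :
    X ^ N ∣ K.V * (1 + K.V) ^ 2 -
      ∑ k ∈ Finset.range N, ((k + 1).choose 2 : S⟦X⟧) * K.q ^ k := by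
  have h := K.one_sub_mul
  have h0 := one_sub_mul_sum_pow K.q N
  have h2 := one_sub_mul_sum_choose_mul_pow K.q N
  have h3 := K.X_pow_dvd_sub_sum N
  have h4 := K.X_pow_dvd_q_pow N
  generalize ∑ k ∈ Finset.range N, ((k : S⟦X⟧) + 1) * K.q ^ k = a at *
  generalize ∑ k ∈ Finset.range N, K.q ^ k = b at *
  generalize ∑ k ∈ Finset.range N, ((k + 1).choose 2 : S⟦X⟧) * K.q ^ k = c at *
  have e : K.V * (1 + K.V) ^ 2 - c = (1 + K.V) * ((1 + K.V) ^ 2 - a)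
      + K.q ^ N * ((1 + K.V) * N.choose 2 - (1 + K.V) ^ 2) := by
    linear_combination (c - (1 + K.V) * b) * h - (1 + K.V) * h2 + (1 + K.V) ^ 2 * h0
  rw [e]
  exact dvd_add (h3.mul_left _) (h4.mul_right _)

/-- `Q` plays the role of Σ w k q^k; agreement with the truncated sum modulo X^(n+1) suffices to
read off the coefficient of X^n. -/
theorem coeff_mul_eq_sum (B Q : S⟦X⟧) (w : ℕ → ℕ) (n r : ℕ)
    (h : X ^ (n + 1) ∣ Q - ∑ k ∈ Finset.range (n + 1), (w k : S⟦X⟧) * K.q ^ k) :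
    coeff n (B * K.q ^ r * Q) =
      ∑ k ∈ Finset.range (n + 1), (w k : S) * coeff n (B * K.q ^ (r + k)) := by
  have h1 := X_pow_dvd_iff.1 (h.mul_left (B * K.q ^ r)) n (Nat.lt_succ_self n)
  rw [mul_sub, map_sub, sub_eq_zero] at h1
  rw [h1, Finset.mul_sum, map_sum]
  refine Finset.sum_congr rfl fun k _ => ?_
  have : B * K.q ^ r * ((w k : S⟦X⟧) * K.q ^ k) = C (w k : S) * (B * K.q ^ (r + k)) := by
    rw [map_natCast]; ring
  rw [this, coeff_C_mul]

/-- Abbreviation for the coefficients of the claimed solution. -/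
noncomputable def sol (n r : ℕ) : S := coeff n (K.A * K.q ^ r)

theorem coeff_single (n r : ℕ) : coeff n (K.A * K.q ^ r * (1 + K.V) ^ 2) =
    ∑ k ∈ Finset.range (n + 1), ((k + 1 : ℕ) : S) * K.sol n (r + k) := by
  refine K.coeff_mul_eq_sum K.A _ (fun k => k + 1) n r ?_
  simpa using K.X_pow_dvd_sub_sum (n + 1)

theorem coeff_choose (n r : ℕ) : coeff n (K.A * K.q ^ r * (K.V * (1 + K.V) ^ 2)) =
    ∑ k ∈ Finset.range (n + 1), ((k + 1).choose 2 : S) * K.sol n (r + k) :=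
  K.coeff_mul_eq_sum K.A _ (fun k => (k + 1).choose 2) n r (K.X_pow_dvd_sub_sum_choose (n + 1))

theorem A_mul_q_pow_zero : K.A * K.q ^ 0 = 1 + X * (C y * (K.A * K.q ^ 0 * (1 + K.V) ^ 2))
    + X * (X * (C y * (K.A * K.q ^ 0 * (K.V * (1 + K.V) ^ 2)))) := by
  linear_combination K.A_eq

/-- The equation for q, multiplied by A q^r, serves every positive rank at once; this is what makes
a geometric solution possible. -/
theorem A_mul_q_pow_succ (r : ℕ) :
    K.A * K.q ^ (r + 1) = X * (C y * (K.A * K.q ^ (r + 1) * (1 + K.V) ^ 2))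
    + X * (X * (C y * (K.A * K.q ^ r * (1 + K.V) ^ 2)))
    + X * (X * (C y * (K.A * K.q ^ (r + 1) * (K.V * (1 + K.V) ^ 2)))) := by
  linear_combination K.A * K.q ^ r * K.q_eq

theorem sol_zero (r : ℕ) : K.sol 0 r = if r = 0 then 1 else 0 := by
  cases r with
  | zero => rw [sol, A_mul_q_pow_zero]; simp
  | succ r => rw [sol, A_mul_q_pow_succ]; simp

theorem sol_one (r : ℕ) :
    K.sol 1 r = y * ∑ k ∈ Finset.range 1, ((k + 1 : ℕ) : S) * K.sol 0 (r + k) := by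
  rw [← K.coeff_single, sol]
  cases r with
  | zero =>
    conv_lhs => rw [A_mul_q_pow_zero]
    simp [coeff_succ_X_mul, coeff_one, -coeff_zero_eq_constantCoeff, coeff_C_mul, coeff_zero_X_mul]
  | succ r =>
    conv_lhs => rw [A_mul_q_pow_succ]
    simp [coeff_succ_X_mul, -coeff_zero_eq_constantCoeff, coeff_C_mul, coeff_zero_X_mul]

theorem sol_add_two (n r : ℕ) : K.sol (n + 2) r =
    y * ∑ k ∈ Finset.range (n + 2), ((k + 1 : ℕ) : S) * K.sol (n + 1) (r + k)
    + y * ((if r = 0 then 0 else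
        ∑ k ∈ Finset.range (n + 1), ((k + 1 : ℕ) : S) * K.sol n (r - 1 + k))
      + ∑ k ∈ Finset.range (n + 1), ((k + 1).choose 2 : S) * K.sol n (r + k)) := by
  rw [← K.coeff_single, ← K.coeff_single, ← K.coeff_choose, sol]
  cases r with
  | zero =>
    conv_lhs => rw [A_mul_q_pow_zero]
    simp [coeff_succ_X_mul, coeff_one, coeff_C_mul]
  | succ r =>
    conv_lhs => rw [A_mul_q_pow_succ]
    simp only [map_add, coeff_succ_X_mul, coeff_C_mul, Nat.succ_ne_zero, if_false,
      Nat.add_sub_cancel]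
    ring

/-- The generating function with the rank marked by `z`, given its refinement by rank. -/
theorem one_sub_mul_eq_A (z : S) (E : S⟦X⟧)
    (hE : ∀ n, coeff n E = ∑ r ∈ Finset.range (n + 1), z ^ r * K.sol n r) :
    E * (1 - C z * K.q) = K.A := by
  rw [← sub_eq_zero]
  apply eq_zero_of_forall_X_pow_dvd
  intro N
  have hq : ∀ n r, n < r → K.sol n r = 0 := fun n r h =>
    X_pow_dvd_iff.1 ((K.X_pow_dvd_q_pow r).mul_left K.A) n h
  have h1 : X ^ N ∣ E - ∑ r ∈ Finset.range N, (C z * K.q) ^ r * K.A := by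
    rw [X_pow_dvd_iff]
    intro n hn
    rw [map_sub, hE, map_sum, sub_eq_zero]
    have : ∀ r, coeff n ((C z * K.q) ^ r * K.A) = z ^ r * K.sol n r := by
      intro r
      rw [sol, mul_pow, ← map_pow, mul_assoc, coeff_C_mul, mul_comm (K.q ^ r)]
    simp only [this]
    refine Finset.sum_subset (Finset.range_subset_range.2 hn) ?_
    intro r _ hr
    rw [hq n r (by simpa using hr), mul_zero]
  have h2 := one_sub_mul_sum_pow (C z * K.q) N
  have h3 : X ^ N ∣ (C z * K.q) ^ N := by
    rw [mul_pow]; exact (K.X_pow_dvd_q_pow N).mul_left _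
  rw [← Finset.sum_mul] at h1
  generalize ∑ k ∈ Finset.range N, (C z * K.q) ^ k = b at *
  have e : E * (1 - C z * K.q) - K.A = (E - b * K.A) * (1 - C z * K.q)
      - (C z * K.q) ^ N * K.A := by linear_combination K.A * h2
  rw [e]
  exact dvd_sub (h1.mul_right _) (h3.mul_right _)

theorem eval_quartic_eq_zero [IsDomain S] (z : S) (E : S⟦X⟧) (hE : E * (1 - C z * K.q) = K.A) :
    (quartic X (C y) (C z)).eval E = 0 := by
  have h := K.one_sub_mul
  have h1 : X * E * (1 - C z * K.q) * (1 - K.q) = X + (1 - X) * K.q * (1 - K.q) := by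
    linear_combination X * (1 - K.q) * hE + (1 - K.q) * K.X_mul_A + X * h
  have h2 : X ^ 2 * C y * E * (1 - C z * K.q) = K.q * (1 - K.q) ^ 2 := by
    have h3 : X ^ 2 * C y * K.A = K.V * (1 - K.q) ^ 3 := by
      have : ((1 - K.q) * (1 + K.V)) ^ 3 = 1 := by rw [h, one_pow]
      linear_combination (1 - K.q) ^ 3 * K.V_eq - X ^ 2 * C y * K.A * this
    linear_combination X ^ 2 * C y * hE + h3 - (1 - K.q) ^ 2 * K.q_mul
  simp only [quartic, Polynomial.eval_add, Polynomial.eval_sub, Polynomial.eval_mul,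
    Polynomial.eval_pow, Polynomial.eval_X, Polynomial.eval_C, Polynomial.eval_one]
  have hα : X * E * C z + (1 - X) ≠ 0 := by
    intro h0
    simpa using congrArg constantCoeff h0
  generalize K.q = q at h1 h2
  exact quartic_of_relations X (C y) (C z) E q X_ne_zero hα h1 h2

end KernelSolution

end Algebra

/-! ### Avoiding words: deleting and inserting the maximal letter -/

section Lists

/-- Lists whose `i`-th entry (counted from `0`) is at most `i`. -/
def IsInvList (l : List ℕ) : Prop := ∀ i v : ℕ, l[i]? = some v → v ≤ i

/-- Lists without a subsequence of the shape `102`. -/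
def Avoids102 (l : List ℕ) : Prop := ∀ a b c, List.Sublist [b, a, c] l → a < b → ¬ b < c

/-- Lists in which each value occurs at most twice. -/
def Avoids000 (l : List ℕ) : Prop := ∀ v, l.count v ≤ 2

/-- The list version of the members of `avoiders`. -/
structure IsAvoider (l : List ℕ) : Prop where
  inv : IsInvList l
  avoids102 : Avoids102 l
  avoids000 : Avoids000 l

/-- The least strict upper bound of the entries. -/
def height : List ℕ → ℕ
  | [] => 0
  | v :: l => max (v + 1) (height l)

/-- The length of the longest weakly increasing prefix. -/
def ascLen : List ℕ → ℕ
  | [] => 0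
  | [_] => 1
  | a :: b :: l => if a ≤ b then ascLen (b :: l) + 1 else 1

theorem height_le_iff {l : List ℕ} {M : ℕ} : height l ≤ M ↔ ∀ v ∈ l, v < M := by
  induction l with
  | nil => simp [height]
  | cons a l ih => simp [height, ih]

theorem height_eq_of_mem {l : List ℕ} {M : ℕ} (hM : M ∈ l) (h : ∀ v ∈ l, v ≤ M) :
    height l = M + 1 := by
  apply le_antisymm
  · exact height_le_iff.2 fun v hv => Nat.lt_succ_of_le (h v hv)
  · exact height_le_iff.1 le_rfl M hM

theorem exists_height_eq {l : List ℕ} (hl : l ≠ []) :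
    ∃ M ∈ l, height l = M + 1 ∧ ∀ v ∈ l, v ≤ M := by
  induction l with
  | nil => exact absurd rfl hl
  | cons a l ih =>
    by_cases h0 : l = []
    · subst h0
      exact ⟨a, by simp, by simp [height], by simp⟩
    · obtain ⟨M, hM, h1, h2⟩ := ih h0
      rcases le_total a M with h | h
      · refine ⟨M, by simp [hM], ?_, ?_⟩
        · simp [height, h1, h]
        · simpa [h] using h2
      · refine ⟨a, by simp, ?_, ?_⟩
        · simp [height, h1, h]
        · simpa using fun v hv => (h2 v hv).trans h

theorem ascLen_le_length (l : List ℕ) : ascLen l ≤ l.length := by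
  fun_induction ascLen l <;> simp_all

theorem one_le_ascLen {l : List ℕ} (hl : l ≠ []) : 1 ≤ ascLen l := by
  fun_cases ascLen l <;> simp_all

theorem pairwise_cons_cons_iff {a b : ℕ} {l : List ℕ} :
    (a :: b :: l).Pairwise (· ≤ ·) ↔ a ≤ b ∧ (b :: l).Pairwise (· ≤ ·) := by
  simp only [List.pairwise_cons, List.mem_cons, forall_eq_or_imp]
  constructor
  · rintro ⟨⟨h1, h2⟩, h3, h4⟩
    exact ⟨h1, h3, h4⟩
  · rintro ⟨h1, h3, h4⟩
    exact ⟨⟨h1, fun c hc => h1.trans (h3 c hc)⟩, h3, h4⟩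

/-- Turns the order condition on the entries before an insertion point into the numerical bound i ≤
p. -/
theorem pairwise_take_iff {l : List ℕ} {i : ℕ} (hi : i ≤ l.length) :
    (l.take i).Pairwise (· ≤ ·) ↔ i ≤ ascLen l := by
  induction l generalizing i with
  | nil => simp_all
  | cons a l ih =>
    cases l with
    | nil =>
      have : i ≤ 1 := by simpa using hi
      interval_cases i <;> simp [ascLen]
    | cons b l =>
      match i with
      | 0 => simp
      | 1 =>
        have := one_le_ascLen (l := a :: b :: l) (by simp)
        simp [this]
      | i + 2 =>
        have ih' := ih (i := i + 1) (by simpa using hi)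
        rw [List.take_succ_cons] at ih'
        rw [List.take_succ_cons, List.take_succ_cons, pairwise_cons_cons_iff, ih', ascLen]
        split_ifs with h
        · simp [h]
        · simp [h]

theorem getElem_ascLen_lt {l : List ℕ} (h : ascLen l < l.length) :
    l[ascLen l] < l[ascLen l - 1]'(by omega) := by
  induction l with
  | nil => simp at h
  | cons a l ih =>
    cases l with
    | nil => simp [ascLen] at h
    | cons b l =>
      by_cases hab : a ≤ b
      · have e : ascLen (a :: b :: l) = ascLen (b :: l) + 1 := by simp [ascLen, hab]
        have h1 := one_le_ascLen (l := b :: l) (by simp)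
        have h' : ascLen (b :: l) < (b :: l).length := by
          rw [e] at h; simpa using h
        have := ih h'
        obtain ⟨k, hk⟩ : ∃ k, ascLen (b :: l) = k + 1 := ⟨_, (Nat.sub_add_cancel h1).symm⟩
        simp only [e, hk] at this ⊢
        simpa using this
      · have e : ascLen (a :: b :: l) = 1 := by simp [ascLen, hab]
        simp only [e]
        simpa using hab

theorem ascLen_append_cons {a b : List ℕ} {M : ℕ} (ha : a.Pairwise (· ≤ ·))
    (haM : ∀ v ∈ a, v ≤ M) (hb : ∀ v, b.head? = some v → v < M) :
    ascLen (a ++ M :: b) = a.length + 1 := by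
  induction a with
  | nil =>
    cases b with
    | nil => simp [ascLen]
    | cons b0 b =>
      have : b0 < M := hb b0 (by simp)
      simp [ascLen, this]
  | cons x a ih =>
    have ih' := ih (List.pairwise_cons.1 ha).2 (fun v hv => haM v (by simp [hv]))
    cases a with
    | nil =>
      have : x ≤ M := haM x (by simp)
      simp only [List.nil_append, List.cons_append, ascLen, this, if_true] at ih' ⊢
      rw [ih']; simp
    | cons x' a =>
      have : x ≤ x' := (pairwise_cons_cons_iff.1 ha).1
      simp only [List.cons_append, ascLen, this, if_true] at ih' ⊢
      rw [ih']; simp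

theorem isInvList_append {a b : List ℕ} (hb : ∀ v ∈ b, v ≤ a.length) :
    IsInvList (a ++ b) ↔ IsInvList a := by
  constructor
  · intro h i v hv
    apply h i v
    rw [List.getElem?_append_left, hv]
    exact (List.getElem?_eq_some_iff.1 hv).1
  · intro h i v hv
    rw [List.getElem?_append] at hv
    split_ifs at hv with hi
    · exact h i v hv
    · exact (hb v (List.mem_of_getElem? hv)).trans (by omega)

theorem IsInvList.le_length {a b : List ℕ} {M : ℕ} (h : IsInvList (a ++ M :: b)) :
    M ≤ a.length := h a.length M (by simp)

theorem sublist_of_concat_sublist {u a b : List ℕ} {M : ℕ} (hb : M ∉ b)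
    (h : List.Sublist (u ++ [M]) (a ++ M :: b)) : List.Sublist u a := by
  obtain ⟨l₁, l₂, h1, h2, h3⟩ := List.sublist_append_iff.1 h
  rcases List.append_eq_append_iff.1 h1 with ⟨w, hw1, hw2⟩ | ⟨w, hw1, hw2⟩
  · subst hw1
    exact (List.sublist_append_left u w).trans h2
  · subst hw1
    subst hw2
    cases w with
    | nil => simpa using h2
    | cons c w =>
      exfalso
      have : List.Sublist (w ++ [M]) b := by
        simpa using h3.tail
      exact hb (this.subset (by simp))

/-- Removing the maximal letter `M` from a list whose last `M` precedes `c`. -/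
theorem avoids102_iff_filter {p c : List ℕ} {M : ℕ} (hc : M ∉ c)
    (hM : ∀ v ∈ p ++ M :: c, v ≤ M) :
    Avoids102 (p ++ M :: c) ↔
      Avoids102 ((p ++ M :: c).filter (· ≠ M)) ∧ (p.filter (· ≠ M)).Pairwise (· ≤ ·) := by
  constructor
  · intro h
    refine ⟨fun x y z hs => h x y z (hs.trans List.filter_sublist), ?_⟩
    rw [List.pairwise_iff_forall_sublist]
    intro x y hs
    have hx : x ∈ p ∧ x ≠ M := by
      simpa using hs.subset (List.mem_cons_self)
    have hs' : List.Sublist [x, y, M] (p ++ M :: c) := by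
      have := (hs.trans List.filter_sublist).append
        (List.singleton_sublist.2 (List.mem_cons_self (a := M) (l := c)))
      simpa using this
    by_contra! hlt
    exact h y x M hs' hlt (lt_of_le_of_ne (hM x (by simp [hx.1])) hx.2)
  · rintro ⟨h1, h2⟩ x y z hs hxy hyz
    have hz := hM z (hs.subset (by simp))
    have hf := hs.filter (· ≠ M)
    -- Being maximal, M can only play the letter 2; if it does not, the whole pattern survives the
    -- deletion of M.
    rcases eq_or_lt_of_le hz with rfl | hz
    · have hs' : List.Sublist [y, x] p := sublist_of_concat_sublist (u := [y, x]) hc hs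
      have hf' := hs'.filter (· ≠ z)
      have hx : x ≠ z := (hxy.trans hyz).ne
      have hy : y ≠ z := hyz.ne
      simp only [ne_eq, hx, hy, not_false_eq_true, decide_true, List.filter_cons_of_pos,
        List.filter_nil] at hf'
      have := (List.pairwise_iff_forall_sublist.1 h2) hf'
      omega
    · have hx : x ≠ M := by omega
      have hy : y ≠ M := by omega
      have hz : z ≠ M := by omega
      simp only [ne_eq, hx, hy, hz, not_false_eq_true, decide_true, List.filter_cons_of_pos,
        List.filter_nil] at hf
      exact h1 x y z (by simpa using hf) hxy hyz

theorem filter_ne_eq_self {l : List ℕ} {M : ℕ} (h : ∀ v ∈ l, v < M) :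
    l.filter (· ≠ M) = l := by
  rw [List.filter_eq_self]
  intro v hv
  simpa using (h v hv).ne

/-- Once M ≤ `a.length`, the position bound is automatic after `a` with or without M, since every
later entry is at most M. -/
theorem isAvoider_insert_iff {a b : List ℕ} {M : ℕ} (ha : ∀ v ∈ a, v < M) (hb : ∀ v ∈ b, v < M) :
    IsAvoider (a ++ M :: b) ↔
      IsAvoider (a ++ b) ∧ M ≤ a.length ∧ a.Pairwise (· ≤ ·) := by
  have hab : M ∉ b := fun h => (hb M h).ne rfl
  have haa : M ∉ a := fun h => (ha M h).ne rfl
  have h102 := avoids102_iff_filter (p := a) hab (M := M) (by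
    intro v hv
    rw [List.mem_append, List.mem_cons] at hv
    rcases hv with h | h | h
    · exact (ha v h).le
    · exact h.le
    · exact (hb v h).le)
  have e : (a ++ M :: b).filter (· ≠ M) = a ++ b := by
    rw [List.filter_append, List.filter_cons_of_neg (by simp), filter_ne_eq_self ha,
      filter_ne_eq_self hb]
  rw [e, filter_ne_eq_self ha] at h102
  have h000 : Avoids000 (a ++ M :: b) ↔ Avoids000 (a ++ b) := by
    refine forall_congr' fun v => ?_
    by_cases hv : v = M
    · subst hv
      simp [List.count_eq_zero_of_not_mem, hab, haa]
    · simp [Ne.symm hv]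
  have hinv : M ≤ a.length → (IsInvList (a ++ M :: b) ↔ IsInvList (a ++ b)) := by
    intro h
    rw [isInvList_append, isInvList_append]
    · exact fun v hv => (hb v hv).le.trans h
    · intro v hv
      rcases List.mem_cons.1 hv with rfl | hv
      · exact h
      · exact (hb v hv).le.trans h
  constructor
  · rintro ⟨h1, h2, h3⟩
    exact ⟨⟨(hinv h1.le_length).1 h1, (h102.1 h2).1, h000.1 h3⟩, h1.le_length, (h102.1 h2).2⟩
  · rintro ⟨⟨h1, h2, h3⟩, h4, h5⟩
    exact ⟨(hinv h4).2 h1, h102.2 ⟨h2, h5⟩, h000.2 h3⟩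

/-- The order condition comes from the last copy of M, hence `a ++ b`; the position bound for the
first copy implies the one for the second. -/
theorem isAvoider_insert_insert_iff {a b c : List ℕ} {M : ℕ} (ha : ∀ v ∈ a, v < M)
    (hb : ∀ v ∈ b, v < M) (hc : ∀ v ∈ c, v < M) :
    IsAvoider (a ++ M :: (b ++ M :: c)) ↔
      IsAvoider (a ++ (b ++ c)) ∧ M ≤ a.length ∧ (a ++ b).Pairwise (· ≤ ·) := by
  have haa : M ∉ a := fun h => (ha M h).ne rfl
  have hbb : M ∉ b := fun h => (hb M h).ne rfl
  have hcc : M ∉ c := fun h => (hc M h).ne rfl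
  have hmem : ∀ v ∈ b ++ M :: c, v ≤ M := by
    intro v hv
    rw [List.mem_append, List.mem_cons] at hv
    rcases hv with h | h | h
    · exact (hb v h).le
    · exact h.le
    · exact (hc v h).le
  have h102 := avoids102_iff_filter (p := a ++ M :: b) hcc (M := M) (by
    intro v hv
    rw [List.append_assoc, List.cons_append, List.mem_append, List.mem_cons] at hv
    rcases hv with h | h | h
    · exact (ha v h).le
    · exact h.le
    · exact hmem v h)
  have e' : (a ++ M :: b).filter (· ≠ M) = a ++ b := by
    rw [List.filter_append, List.filter_cons_of_neg (by simp), filter_ne_eq_self ha,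
      filter_ne_eq_self hb]
  have e : (a ++ M :: b ++ M :: c).filter (· ≠ M) = a ++ (b ++ c) := by
    rw [List.filter_append, e', List.filter_cons_of_neg (by simp), filter_ne_eq_self hc,
      List.append_assoc]
  rw [e, e', List.append_assoc, List.cons_append] at h102
  have h000 : Avoids000 (a ++ M :: (b ++ M :: c)) ↔ Avoids000 (a ++ (b ++ c)) := by
    refine forall_congr' fun v => ?_
    by_cases hv : v = M
    · subst hv
      simp [List.count_eq_zero_of_not_mem, haa, hbb, hcc]
    · simp [Ne.symm hv]
  have hinv : M ≤ a.length →
      (IsInvList (a ++ M :: (b ++ M :: c)) ↔ IsInvList (a ++ (b ++ c))) := by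
    intro h
    rw [isInvList_append, isInvList_append]
    · intro v hv
      rcases List.mem_append.1 hv with hv | hv
      · exact (hb v hv).le.trans h
      · exact (hc v hv).le.trans h
    · intro v hv
      rcases List.mem_cons.1 hv with rfl | hv
      · exact h
      · exact (hmem v hv).trans h
  constructor
  · rintro ⟨h1, h2, h3⟩
    exact ⟨⟨(hinv h1.le_length).1 h1, (h102.1 h2).1, h000.1 h3⟩, h1.le_length, (h102.1 h2).2⟩
  · rintro ⟨⟨h1, h2, h3⟩, h4, h5⟩
    exact ⟨(hinv h4).2 h1, h102.2 ⟨h2, h5⟩, h000.2 h3⟩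

end Lists

/-! ### Translation between functions on `Fin n` and lists -/

section Transfer

theorem reduction_lt_reduction {k : ℕ} (u : Fin k → ℕ) {i j : Fin k} (h : u i < u j) :
    reduction u i < reduction u j := by
  apply Finset.card_lt_card
  rw [Finset.ssubset_iff_of_subset]
  · exact ⟨u i, by simp [h], by simp⟩
  · intro v hv
    simp only [Finset.mem_filter] at hv ⊢
    exact ⟨hv.1, hv.2.trans h⟩

theorem reduction_lt_reduction_iff {k : ℕ} (u : Fin k → ℕ) {i j : Fin k} :
    reduction u i < reduction u j ↔ u i < u j := by
  refine ⟨fun h => ?_, reduction_lt_reduction u⟩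
  by_contra! hle
  rcases hle.eq_or_lt with he | hlt
  · simp [reduction, he] at h
  · exact absurd (reduction_lt_reduction u hlt) h.not_gt

theorem reduction_eq_102_iff (u : Fin 3 → ℕ) :
    reduction u = ![1, 0, 2] ↔ u 1 < u 0 ∧ u 0 < u 2 := by
  constructor
  · intro h
    constructor
    · rw [← reduction_lt_reduction_iff, h]; simp
    · rw [← reduction_lt_reduction_iff, h]; simp
  · rintro ⟨h1, h2⟩
    have himg : Finset.univ.image u = {u 1, u 0, u 2} := by
      ext v; simp [Fin.exists_fin_succ, eq_comm]; tauto
    funext i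
    simp only [reduction, himg, Finset.filter_insert, Finset.filter_singleton]
    fin_cases i
    · simp [h1, h2.not_gt]
    · simp [h1.not_gt, (h1.trans h2).not_gt]
    · simp [h2, h1.trans h2, h1.ne]

theorem reduction_eq_000_iff (u : Fin 3 → ℕ) :
    reduction u = ![0, 0, 0] ↔ u 1 = u 0 ∧ u 2 = u 0 := by
  constructor
  · intro h
    have key : ∀ i j, ¬ u i < u j := by
      intro i j
      rw [← reduction_lt_reduction_iff, h]
      fin_cases i <;> fin_cases j <;> simp
    have h1 := key 0 1
    have h2 := key 1 0
    have h3 := key 0 2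
    have h4 := key 2 0
    omega
  · rintro ⟨h1, h2⟩
    have hall : ∀ i, u i = u 0 := by
      intro i
      fin_cases i <;> simp [h1, h2]
    funext i
    have : reduction u i = 0 := by
      rw [reduction, Finset.card_eq_zero, Finset.filter_eq_empty_iff]
      intro v hv
      obtain ⟨j, -, rfl⟩ := Finset.mem_image.1 hv
      simp [hall]
    rw [this]
    fin_cases i <;> rfl

theorem contains_iff_sublist {n : ℕ} (e : Fin n → ℕ) (w : Fin 3 → ℕ) :
    Contains e w ↔ ∃ u : Fin 3 → ℕ, List.Sublist [u 0, u 1, u 2] (List.ofFn e) ∧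
      reduction u = w := by
  constructor
  · rintro ⟨f, hf, hr⟩
    refine ⟨e ∘ f, ?_, hr⟩
    rw [List.sublist_iff_exists_fin_orderEmbedding_get_eq]
    refine ⟨OrderEmbedding.ofStrictMono
      (fun i : Fin 3 => Fin.cast (List.length_ofFn (f := e)).symm (f i)) (fun i j h => hf i j h), ?_⟩
    intro i
    simp only [List.length_cons, List.length_nil] at i
    fin_cases i <;> simp <;> rfl
  · rintro ⟨u, hs, hr⟩
    rw [List.sublist_iff_exists_fin_orderEmbedding_get_eq] at hs
    obtain ⟨g, hg⟩ := hs
    refine ⟨fun i => Fin.cast List.length_ofFn (g i), fun i j h => ?_, ?_⟩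
    · exact g.strictMono h
    · rw [← hr]
      congr 1
      funext i
      have := hg i
      rw [List.get_ofFn] at this
      rw [Function.comp_apply, ← this]
      fin_cases i <;> rfl

theorem isAvoider_ofFn_iff {n : ℕ} (e : Fin n → ℕ) :
    IsAvoider (List.ofFn e) ↔ e ∈ avoiders n := by
  have h1 : IsInvList (List.ofFn e) ↔ e ∈ invSeqs n := by
    simp only [IsInvList, invSeqs, Fintype.mem_piFinset, Finset.mem_range]
    constructor
    · intro h i
      have := h i (e i) (by simp)
      omega
    · intro h i v hv
      rw [List.getElem?_ofFn] at hv
      split_ifs at hv with hi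
      · have := h ⟨i, hi⟩
        simp only [Option.some.injEq] at hv
        simp only at this
        omega
  have h2 : Avoids102 (List.ofFn e) ↔ ¬ Contains e ![1, 0, 2] := by
    rw [contains_iff_sublist]
    simp only [reduction_eq_102_iff]
    constructor
    · rintro h ⟨u, hs, h3, h4⟩
      exact h _ _ _ hs h3 h4
    · intro h a b c hs hab hbc
      exact h ⟨![b, a, c], by simpa using hs, by simpa using ⟨hab, hbc⟩⟩
  have h3 : Avoids000 (List.ofFn e) ↔ ¬ Contains e ![0, 0, 0] := by
    rw [contains_iff_sublist]
    simp only [reduction_eq_000_iff]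
    have key : ∀ v, 3 ≤ (List.ofFn e).count v ↔ List.Sublist [v, v, v] (List.ofFn e) :=
      fun v => (List.replicate_sublist_iff (n := 3)).symm
    constructor
    · rintro h ⟨u, hs, h3, h4⟩
      rw [h3, h4, ← key] at hs
      have := h (u 0)
      omega
    · intro h v
      by_contra! hv
      exact h ⟨![v, v, v], by simpa using (key v).1 hv, by simp⟩
  rw [avoiders, Finset.mem_filter, ← h1, ← h2, ← h3]
  exact ⟨fun h => ⟨h.1, h.2, h.3⟩, fun h => ⟨h.1, h.2.1, h.2.2⟩⟩

/-- The words of the sequences in `avoiders n`. -/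
def avoiderLists (n : ℕ) : Finset (List ℕ) :=
  (avoiders n).map ⟨List.ofFn, List.ofFn_injective⟩

theorem mem_avoiderLists {n : ℕ} {l : List ℕ} :
    l ∈ avoiderLists n ↔ l.length = n ∧ IsAvoider l := by
  simp only [avoiderLists, Finset.mem_map, Function.Embedding.coeFn_mk]
  constructor
  · rintro ⟨e, he, rfl⟩
    exact ⟨List.length_ofFn, (isAvoider_ofFn_iff e).2 he⟩
  · rintro ⟨rfl, h⟩
    refine ⟨l.get, ?_, List.ofFn_get l⟩
    rw [← isAvoider_ofFn_iff, List.ofFn_get]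
    exact h

theorem firstDescent_eq_ascLen {n : ℕ} (e : Fin n → ℕ) (hn : n ≠ 0) :
    firstDescent e = ascLen (List.ofFn e) := by
  have hne : List.ofFn e ≠ [] := by
    simpa [List.ofFn_eq_nil_iff] using hn
  have h1 := one_le_ascLen hne
  have h2 : ascLen (List.ofFn e) ≤ n := by
    simpa using ascLen_le_length (List.ofFn e)
  have hlt : ∀ h : ascLen (List.ofFn e) < (List.ofFn e).length,
    (List.ofFn e)[ascLen (List.ofFn e)] < (List.ofFn e)[ascLen (List.ofFn e) - 1] :=
    fun h => getElem_ascLen_lt h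
  have hs := (pairwise_take_iff (l := List.ofFn e) (by simpa using h2)).2 le_rfl
  obtain ⟨p, hp⟩ : ∃ p, p = ascLen (List.ofFn e) := ⟨_, rfl⟩
  simp only [← hp] at h1 h2 hlt hs ⊢
  have hmem : p ∈ {p : ℕ | 1 ≤ p ∧ p ≤ n ∧ entry e (p + 1) < entry e p} := by
    refine ⟨h1, h2, ?_⟩
    simp only [entry, h1, h2, and_self, dif_pos]
    -- If p = n there is no next entry, and the convention -1 makes the end a descent.
    split_ifs with h
    · have := hlt (by simpa using h.2)
      simp only [List.getElem_ofFn] at this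
      exact_mod_cast this
    · omega
  apply le_antisymm (Nat.sInf_le hmem)
  apply le_csInf ⟨p, hmem⟩
  rintro k ⟨hk1, hk2, hk3⟩
  by_contra! hkp
  rw [List.pairwise_iff_getElem] at hs
  have := hs (k - 1) k (by simp; omega) (by simp; omega) (by omega)
  simp only [List.getElem_take, List.getElem_ofFn] at this
  simp only [entry, hk1, hk2, show 1 ≤ k + 1 ∧ k + 1 ≤ n by omega, and_self, dif_pos,
    Nat.add_sub_cancel] at hk3
  omega

theorem sup_add_one_eq_height {n : ℕ} (e : Fin n → ℕ) (hn : n ≠ 0) :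
    Finset.univ.sup e + 1 = height (List.ofFn e) := by
  have hne : List.ofFn e ≠ [] := by
    simpa [List.ofFn_eq_nil_iff] using hn
  obtain ⟨M, hM, h1, h2⟩ := exists_height_eq hne
  rw [h1]
  congr 1
  obtain ⟨i, rfl⟩ := (List.mem_ofFn' e M).1 hM
  apply le_antisymm
  · apply Finset.sup_le
    intro j _
    exact h2 _ ((List.mem_ofFn' e _).2 ⟨j, rfl⟩)
  · exact Finset.le_sup (f := e) (Finset.mem_univ i)

theorem Avoids102.pairwise_of_max {a b : List ℕ} {M : ℕ} (h : Avoids102 (a ++ M :: b))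
    (ha : ∀ v ∈ a, v < M) : a.Pairwise (· ≤ ·) := by
  rw [List.pairwise_iff_forall_sublist]
  intro x y hs
  have hs' : List.Sublist [x, y, M] (a ++ M :: b) := by
    have := hs.append (List.singleton_sublist.2 (List.mem_cons_self (a := M) (l := b)))
    simpa using this
  by_contra! hlt
  exact h y x M hs' hlt (ha x (hs.subset (by simp)))

/-- The rank of the word of an avoiding sequence. -/
def listRank (l : List ℕ) : ℕ := ascLen l - height l

/-- At least M entries precede the first maximum M, and they are weakly increasing. Hence the rank
is nonnegative and the truncated subtraction in `listRank` is faithful. -/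
theorem IsAvoider.height_le_ascLen {l : List ℕ} (h : IsAvoider l) : height l ≤ ascLen l := by
  by_cases hl : l = []
  · simp [hl, height]
  obtain ⟨M, hM, h1, h2⟩ := exists_height_eq hl
  obtain ⟨a, b, rfl, ha⟩ := List.eq_append_cons_of_mem hM
  have ha' : ∀ v ∈ a, v < M := fun v hv =>
    lt_of_le_of_ne (h2 v (by simp [hv])) (fun e => ha (e ▸ hv))
  have hp := h.avoids102.pairwise_of_max ha'
  have hle := h.inv.le_length
  have h3 : a.length + 1 ≤ ascLen (a ++ M :: b) := by
    rw [← pairwise_take_iff (by simp)]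
    have e : (a ++ M :: b).take (a.length + 1) = a ++ [M] := by
      rw [List.take_append]; simp
    rw [e, List.pairwise_append]
    refine ⟨hp, by simp, ?_⟩
    intro x hx y hy
    rw [List.mem_singleton.1 hy]
    exact (ha' x hx).le
  omega

theorem rank_eq_listRank {n : ℕ} {e : Fin n → ℕ} (he : e ∈ avoiders n) :
    rank e = (listRank (List.ofFn e) : ℤ) := by
  rw [rank]
  split_ifs with hn
  · subst hn
    simp [listRank, height, ascLen]
  · have h1 := ((isAvoider_ofFn_iff e).2 he).height_le_ascLen
    have h2 := sup_add_one_eq_height e hn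
    rw [firstDescent_eq_ascLen e hn, listRank]
    omega

theorem dist_eq_card_toFinset {n : ℕ} (e : Fin n → ℕ) :
    dist e = (List.ofFn e).toFinset.card := by
  rw [dist]
  congr 1
  ext v
  simp [List.mem_ofFn]

end Transfer

/-! ### Insertions: counting the places, effect on the rank, invertibility -/

section Recursion

/-- The multiplicity of the largest entry. -/
def topMult (l : List ℕ) : ℕ := l.count (height l - 1)

/-- Insertion of one copy of `M` at index `i`. -/
def insertOne (l : List ℕ) (M i : ℕ) : List ℕ := l.take i ++ M :: l.drop i

/-- Insertion of two copies of `M` before the entries with index `i` and `j`. -/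
def insertTwo (l : List ℕ) (M i j : ℕ) : List ℕ :=
  l.take i ++ M :: ((l.drop i).take (j - i) ++ M :: (l.drop i).drop (j - i))

/-- The admissible `(M, i)` in `insertOne`, for a list of height `h` whose longest weakly
increasing prefix has length `p`. -/
def onePlaces (h p : ℕ) : Finset (ℕ × ℕ) :=
  (Finset.range (p + 1) ×ˢ Finset.range (p + 1)).filter fun s => h ≤ s.1 ∧ s.1 ≤ s.2

/-- The admissible `(M, i, j)` in `insertTwo`. -/
def twoPlaces (h p : ℕ) : Finset (ℕ × ℕ × ℕ) :=
  (Finset.range (p + 1) ×ˢ Finset.range (p + 1) ×ˢ Finset.range (p + 1)).filter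
    fun s => h ≤ s.1 ∧ s.1 ≤ s.2.1 ∧ s.2.1 ≤ s.2.2

theorem mem_onePlaces {h p : ℕ} {s : ℕ × ℕ} :
    s ∈ onePlaces h p ↔ h ≤ s.1 ∧ s.1 ≤ s.2 ∧ s.2 ≤ p := by
  simp only [onePlaces, Finset.mem_filter, Finset.mem_product, Finset.mem_range]
  omega

theorem mem_twoPlaces {h p : ℕ} {s : ℕ × ℕ × ℕ} :
    s ∈ twoPlaces h p ↔ h ≤ s.1 ∧ s.1 ≤ s.2.1 ∧ s.2.1 ≤ s.2.2 ∧ s.2.2 ≤ p := by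
  simp only [twoPlaces, Finset.mem_filter, Finset.mem_product, Finset.mem_range]
  omega

theorem card_onePlaces_rank {h p : ℕ} (r : ℕ) (hp : h ≤ p) :
    ((onePlaces h p).filter fun s => s.2 - s.1 = r).card = p - h + 1 - r := by
  have e : (onePlaces h p).filter (fun s => s.2 - s.1 = r) =
      (Finset.range (p - h + 1 - r)).image fun k => (h + k, h + k + r) := by
    ext ⟨M, i⟩
    simp only [Finset.mem_filter, mem_onePlaces, Finset.mem_image, Finset.mem_range, Prod.mk.injEq]
    constructor
    · intro H
      exact ⟨M - h, by omega, by omega, by omega⟩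
    · rintro ⟨k, H⟩
      omega
  rw [e, Finset.card_image_of_injective, Finset.card_range]
  intro a b hab
  simpa using hab

theorem card_twoPlaces_eq_rank {h p : ℕ} (r : ℕ) (hp : h ≤ p) :
    ((twoPlaces h p).filter fun s => s.2.1 = s.2.2 ∧ s.2.1 + 1 - s.1 = r).card =
      if r = 0 then 0 else p - h + 1 - (r - 1) := by
  split_ifs with hr
  · rw [Finset.card_eq_zero, Finset.filter_eq_empty_iff]
    intro s hs
    rw [mem_twoPlaces] at hs
    omega
  have e : (twoPlaces h p).filter (fun s => s.2.1 = s.2.2 ∧ s.2.1 + 1 - s.1 = r) =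
      (Finset.range (p - h + 1 - (r - 1))).image
        fun k => (h + k, h + k + (r - 1), h + k + (r - 1)) := by
    ext ⟨M, i, j⟩
    simp only [Finset.mem_filter, mem_twoPlaces, Finset.mem_image, Finset.mem_range, Prod.mk.injEq]
    constructor
    · intro H
      exact ⟨M - h, by omega, by omega, by omega, by omega⟩
    · rintro ⟨k, H⟩
      omega
  rw [e, Finset.card_image_of_injective, Finset.card_range]
  intro a b hab
  simpa using hab

theorem card_sigma_range (N : ℕ) :
    ((Finset.range N).sigma fun b => Finset.range b).card = N.choose 2 := by
  rw [Finset.card_sigma]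
  simp only [Finset.card_range]
  rw [Finset.sum_range_id, Nat.choose_two_right]

/-- With i = M + r forced, M - h < j - h - r ≤ p - h - r, so the choices are the 2-subsets of a set
of size p - h + 1 - r. -/
theorem card_twoPlaces_lt_rank {h p : ℕ} (r : ℕ) (hp : h ≤ p) :
    ((twoPlaces h p).filter fun s => s.2.1 < s.2.2 ∧ s.2.1 - s.1 = r).card =
      (p - h + 1 - r).choose 2 := by
  have e : (twoPlaces h p).filter (fun s => s.2.1 < s.2.2 ∧ s.2.1 - s.1 = r) =
      ((Finset.range (p - h + 1 - r)).sigma fun b => Finset.range b).image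
        fun k : Sigma fun _ : ℕ => ℕ => (h + k.2, h + k.2 + r, h + r + k.1) := by
    ext ⟨M, i, j⟩
    simp only [Finset.mem_filter, mem_twoPlaces, Finset.mem_image, Finset.mem_range, Prod.mk.injEq,
      Finset.mem_sigma, Sigma.exists]
    constructor
    · intro H
      exact ⟨j - h - r, M - h, by omega, by omega, by omega, by omega⟩
    · rintro ⟨k, k', H⟩
      omega
  rw [e, Finset.card_image_of_injective, card_sigma_range]
  rintro ⟨a, b⟩ ⟨a', b'⟩ hab
  simp only [Prod.mk.injEq, add_right_inj] at hab
  obtain ⟨h1, -, h2⟩ := hab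
  subst h1 h2
  rfl

theorem takeWhile_ne_append_cons {a b : List ℕ} {M : ℕ} (ha : ∀ v ∈ a, v < M) :
    (a ++ M :: b).takeWhile (· ≠ M) = a := by
  rw [List.takeWhile_append_of_pos]
  · simp
  · intro v hv
    simpa using (ha v hv).ne

theorem filter_ne_append_cons {a b : List ℕ} {M : ℕ} (ha : ∀ v ∈ a, v < M) :
    (a ++ M :: b).filter (· ≠ M) = a ++ b.filter (· ≠ M) := by
  rw [List.filter_append, List.filter_cons_of_neg (by simp), filter_ne_eq_self ha]

theorem forall_mem_take_lt {l : List ℕ} {M : ℕ} (h : height l ≤ M) (i : ℕ) :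
    ∀ v ∈ l.take i, v < M :=
  fun v hv => height_le_iff.1 h v (List.mem_of_mem_take hv)

theorem forall_mem_drop_lt {l : List ℕ} {M : ℕ} (h : height l ≤ M) (i : ℕ) :
    ∀ v ∈ l.drop i, v < M :=
  fun v hv => height_le_iff.1 h v (List.mem_of_mem_drop hv)

section InsertOne

variable {l : List ℕ} {M i : ℕ}

theorem height_insertOne (hM : height l ≤ M) : height (insertOne l M i) = M + 1 := by
  apply height_eq_of_mem
  · simp [insertOne]
  · intro v hv
    rw [insertOne, List.mem_append, List.mem_cons] at hv
    rcases hv with h | h | h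
    · exact (forall_mem_take_lt hM i v h).le
    · exact h.le
    · exact (forall_mem_drop_lt hM i v h).le

theorem topMult_insertOne (hM : height l ≤ M) : topMult (insertOne l M i) = 1 := by
  have h1 : M ∉ l.take i := fun h => (forall_mem_take_lt hM i M h).ne rfl
  have h2 : M ∉ l.drop i := fun h => (forall_mem_drop_lt hM i M h).ne rfl
  rw [topMult, height_insertOne hM, insertOne]
  simp [List.count_eq_zero_of_not_mem, h1, h2]

theorem filter_insertOne (hM : height l ≤ M) : (insertOne l M i).filter (· ≠ M) = l := by
  rw [insertOne, filter_ne_append_cons (forall_mem_take_lt hM i),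
    filter_ne_eq_self (forall_mem_drop_lt hM i), List.take_append_drop]

theorem isAvoider_insertOne (hl : IsAvoider l) (h : (M, i) ∈ onePlaces (height l) (ascLen l)) :
    IsAvoider (insertOne l M i) := by
  rw [mem_onePlaces] at h
  simp only at h
  have hi : i ≤ l.length := h.2.2.trans (ascLen_le_length l)
  rw [insertOne, isAvoider_insert_iff (forall_mem_take_lt h.1 i) (forall_mem_drop_lt h.1 i)]
  refine ⟨by rwa [List.take_append_drop], by simp; omega, ?_⟩
  exact (pairwise_take_iff hi).2 h.2.2

/-- Every entry after the new maximum is smaller, so the increasing prefix ends with it and has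
length i + 1, against height M + 1. -/
theorem listRank_insertOne (h : (M, i) ∈ onePlaces (height l) (ascLen l)) :
    listRank (insertOne l M i) = i - M := by
  rw [mem_onePlaces] at h
  simp only at h
  have hi : i ≤ l.length := h.2.2.trans (ascLen_le_length l)
  rw [listRank, height_insertOne h.1, insertOne, ascLen_append_cons]
  · simp; omega
  · exact (pairwise_take_iff hi).2 h.2.2
  · exact fun v hv => (forall_mem_take_lt h.1 i v hv).le
  · exact fun v hv => forall_mem_drop_lt h.1 i v (List.mem_of_head? hv)

theorem card_toFinset_of_filter {l l' : List ℕ} {M : ℕ} (hM : height l ≤ M) (h : M ∈ l')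
    (hf : l'.filter (· ≠ M) = l) : l'.toFinset.card = l.toFinset.card + 1 := by
  have : l'.toFinset = insert M l.toFinset := by
    rw [← hf]
    ext v
    by_cases hv : v = M <;> simp [hv, h]
  rw [this, Finset.card_insert_of_notMem]
  intro hm
  exact (height_le_iff.1 hM M (by simpa using hm)).ne rfl

/-- The result determines M as its maximum, `l` by deleting M, and i as the number of letters before
M. -/
theorem insertOne_injective {l' : List ℕ} {M' i' : ℕ}
    (h : (M, i) ∈ onePlaces (height l) (ascLen l))
    (h' : (M', i') ∈ onePlaces (height l') (ascLen l'))
    (he : insertOne l M i = insertOne l' M' i') : l = l' ∧ M = M' ∧ i = i' := by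
  rw [mem_onePlaces] at h h'
  simp only at h h'
  have hM : M = M' := by
    have := congrArg height he
    rw [height_insertOne h.1, height_insertOne h'.1] at this
    omega
  subst hM
  have hl : l = l' := by
    have := congrArg (List.filter (· ≠ M)) he
    rwa [filter_insertOne h.1, filter_insertOne h'.1] at this
  subst hl
  refine ⟨rfl, rfl, ?_⟩
  have := congrArg (fun t => (List.takeWhile (· ≠ M) t).length) he
  simp only [insertOne] at this
  rw [takeWhile_ne_append_cons (forall_mem_take_lt h.1 i),
    takeWhile_ne_append_cons (forall_mem_take_lt h.1 i')] at this
  have hl := ascLen_le_length l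
  simp only [List.length_take] at this
  omega

theorem exists_eq_insertOne {l : List ℕ} (hl : IsAvoider l) (h1 : topMult l = 1) :
    ∃ l' M i, IsAvoider l' ∧ l.length = l'.length + 1 ∧
      (M, i) ∈ onePlaces (height l') (ascLen l') ∧ insertOne l' M i = l := by
  have hne : l ≠ [] := by
    rintro rfl
    simp [topMult] at h1
  obtain ⟨M, hM, h2, h3⟩ := exists_height_eq hne
  rw [topMult, h2, Nat.add_sub_cancel] at h1
  obtain ⟨a, b, rfl, ha⟩ := List.eq_append_cons_of_mem hM
  have hb : M ∉ b := by
    rw [List.count_append, List.count_cons_self] at h1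
    rw [← List.count_eq_zero]
    omega
  have ha' : ∀ v ∈ a, v < M := fun v hv =>
    lt_of_le_of_ne (h3 v (by simp [hv])) (fun e => ha (e ▸ hv))
  have hb' : ∀ v ∈ b, v < M := fun v hv =>
    lt_of_le_of_ne (h3 v (by simp [hv])) (fun e => hb (e ▸ hv))
  obtain ⟨h4, h5, h6⟩ := (isAvoider_insert_iff ha' hb').1 hl
  refine ⟨a ++ b, M, a.length, h4, by simp; omega, ?_, by simp [insertOne]⟩
  rw [mem_onePlaces]
  refine ⟨height_le_iff.2 ?_, h5, ?_⟩
  · intro v hv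
    rcases List.mem_append.1 hv with h | h
    · exact ha' v h
    · exact hb' v h
  · rw [← pairwise_take_iff (by simp)]
    simpa using h6

end InsertOne

section InsertTwo

variable {l : List ℕ} {M i j : ℕ}

theorem height_insertTwo (hM : height l ≤ M) : height (insertTwo l M i j) = M + 1 := by
  apply height_eq_of_mem
  · simp [insertTwo]
  · intro v hv
    rw [insertTwo, List.mem_append, List.mem_cons, List.mem_append, List.mem_cons] at hv
    rcases hv with h | h | h | h | h
    · exact (forall_mem_take_lt hM i v h).le
    · exact h.le
    · exact (forall_mem_drop_lt hM i v (List.mem_of_mem_take h)).le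
    · exact h.le
    · exact (forall_mem_drop_lt hM i v (List.mem_of_mem_drop h)).le

theorem topMult_insertTwo (hM : height l ≤ M) : topMult (insertTwo l M i j) = 2 := by
  have h1 : M ∉ l.take i := fun h => (forall_mem_take_lt hM i M h).ne rfl
  have h2 : M ∉ l.drop i := fun h => (forall_mem_drop_lt hM i M h).ne rfl
  have h3 : M ∉ (l.drop i).take (j - i) := fun h => h2 (List.mem_of_mem_take h)
  have h4 : M ∉ (l.drop i).drop (j - i) := fun h => h2 (List.mem_of_mem_drop h)
  rw [topMult, height_insertTwo hM, insertTwo, Nat.add_sub_cancel, List.count_append,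
    List.count_cons_self, List.count_append, List.count_cons_self,
    List.count_eq_zero_of_not_mem h1, List.count_eq_zero_of_not_mem h3,
    List.count_eq_zero_of_not_mem h4]

theorem filter_insertTwo (hM : height l ≤ M) : (insertTwo l M i j).filter (· ≠ M) = l := by
  rw [insertTwo, filter_ne_append_cons (forall_mem_take_lt hM i), filter_ne_append_cons,
    filter_ne_eq_self, List.take_append_drop, List.take_append_drop]
  · exact fun v hv => forall_mem_drop_lt hM i v (List.mem_of_mem_drop hv)
  · exact fun v hv => forall_mem_drop_lt hM i v (List.mem_of_mem_take hv)

theorem isAvoider_insertTwo (hl : IsAvoider l)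
    (h : (M, i, j) ∈ twoPlaces (height l) (ascLen l)) : IsAvoider (insertTwo l M i j) := by
  rw [mem_twoPlaces] at h
  simp only at h
  have hl' := ascLen_le_length l
  rw [insertTwo, isAvoider_insert_insert_iff (forall_mem_take_lt h.1 i)
    (fun v hv => forall_mem_drop_lt h.1 i v (List.mem_of_mem_take hv))
    (fun v hv => forall_mem_drop_lt h.1 i v (List.mem_of_mem_drop hv))]
  refine ⟨by rwa [List.take_append_drop, List.take_append_drop], by simp; omega, ?_⟩
  rw [← List.take_add, pairwise_take_iff (by omega)]
  omega

/-- For i = j the second copy prolongs the increasing prefix by one; for i < j a smaller entry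
follows the first copy and ends it. -/
theorem listRank_insertTwo (h : (M, i, j) ∈ twoPlaces (height l) (ascLen l)) :
    listRank (insertTwo l M i j) = if i = j then i + 1 - M else i - M := by
  rw [mem_twoPlaces] at h
  simp only at h
  have hl' := ascLen_le_length l
  have hs : (l.take i).Pairwise (· ≤ ·) := (pairwise_take_iff (by omega)).2 (by omega)
  rw [listRank, height_insertTwo h.1]
  split_ifs with hij
  · subst hij
    have e : insertTwo l M i i = (l.take i ++ [M]) ++ M :: l.drop i := by simp [insertTwo]
    rw [e, ascLen_append_cons]
    · simp; omega
    · rw [List.pairwise_append]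
      refine ⟨hs, by simp, ?_⟩
      intro v hv w hw
      rw [List.mem_singleton.1 hw]
      exact (forall_mem_take_lt h.1 i v hv).le
    · intro v hv
      rcases List.mem_append.1 hv with hv | hv
      · exact (forall_mem_take_lt h.1 i v hv).le
      · exact (List.mem_singleton.1 hv).le
    · exact fun v hv => forall_mem_drop_lt h.1 i v (List.mem_of_head? hv)
  · rw [insertTwo, ascLen_append_cons hs (fun v hv => (forall_mem_take_lt h.1 i v hv).le)]
    · simp; omega
    · intro v hv
      have hne : (l.drop i).take (j - i) ≠ [] := by
        rw [← List.length_pos_iff]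
        simp only [List.length_take, List.length_drop]
        omega
      rw [List.head?_append_of_ne_nil _ hne] at hv
      exact forall_mem_drop_lt h.1 i v (List.mem_of_mem_take (List.mem_of_head? hv))

theorem insertTwo_injective {l' : List ℕ} {M' i' j' : ℕ}
    (h : (M, i, j) ∈ twoPlaces (height l) (ascLen l))
    (h' : (M', i', j') ∈ twoPlaces (height l') (ascLen l'))
    (he : insertTwo l M i j = insertTwo l' M' i' j') : l = l' ∧ M = M' ∧ i = i' ∧ j = j' := by
  rw [mem_twoPlaces] at h h'
  simp only at h h'
  have hM : M = M' := by
    have := congrArg height he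
    rw [height_insertTwo h.1, height_insertTwo h'.1] at this
    omega
  subst hM
  have hl : l = l' := by
    have := congrArg (List.filter (· ≠ M)) he
    rwa [filter_insertTwo h.1, filter_insertTwo h'.1] at this
  subst hl
  have hlen := ascLen_le_length l
  have hi : i = i' := by
    have := congrArg (fun t => (List.takeWhile (· ≠ M) t).length) he
    simp only [insertTwo] at this
    rw [takeWhile_ne_append_cons (forall_mem_take_lt h.1 i),
      takeWhile_ne_append_cons (forall_mem_take_lt h.1 i')] at this
    simp only [List.length_take] at this
    omega
  subst hi
  refine ⟨rfl, rfl, rfl, ?_⟩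
  simp only [insertTwo, List.append_cancel_left_eq, List.cons.injEq, true_and] at he
  have := congrArg (fun t => (List.takeWhile (· ≠ M) t).length) he
  rw [takeWhile_ne_append_cons
      (fun v hv => forall_mem_drop_lt h.1 i v (List.mem_of_mem_take hv)),
    takeWhile_ne_append_cons
      (fun v hv => forall_mem_drop_lt h.1 i v (List.mem_of_mem_take hv))] at this
  simp only [List.length_take, List.length_drop] at this
  omega

/-- The empty list is excluded because its `topMult` is 0; otherwise 000-avoidance forces
multiplicity 2. -/
theorem exists_eq_insertTwo {l : List ℕ} (hl : IsAvoider l) (hne : l ≠ []) (h1 : topMult l ≠ 1) :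
    ∃ l' M i j, IsAvoider l' ∧ l.length = l'.length + 2 ∧
      (M, i, j) ∈ twoPlaces (height l') (ascLen l') ∧ insertTwo l' M i j = l := by
  obtain ⟨M, hM, h2, h3⟩ := exists_height_eq hne
  rw [topMult, h2, Nat.add_sub_cancel] at h1
  have hle := hl.avoids000 M
  obtain ⟨a, t, rfl, ha⟩ := List.eq_append_cons_of_mem hM
  rw [List.count_append, List.count_cons_self, List.count_eq_zero_of_not_mem ha] at h1 hle
  have ht : M ∈ t := by
    rw [← List.count_pos_iff]
    omega
  obtain ⟨b, c, rfl, hb⟩ := List.eq_append_cons_of_mem ht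
  rw [List.count_append, List.count_cons_self, List.count_eq_zero_of_not_mem hb] at hle
  have hc : M ∉ c := by
    rw [← List.count_eq_zero]
    omega
  have ha' : ∀ v ∈ a, v < M := fun v hv =>
    lt_of_le_of_ne (h3 v (by simp [hv])) (fun e => ha (e ▸ hv))
  have hb' : ∀ v ∈ b, v < M := fun v hv =>
    lt_of_le_of_ne (h3 v (by simp [hv])) (fun e => hb (e ▸ hv))
  have hc' : ∀ v ∈ c, v < M := fun v hv =>
    lt_of_le_of_ne (h3 v (by simp [hv])) (fun e => hc (e ▸ hv))
  obtain ⟨h4, h5, h6⟩ := (isAvoider_insert_insert_iff ha' hb' hc').1 hl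
  refine ⟨a ++ (b ++ c), M, a.length, a.length + b.length, h4, by simp; omega, ?_,
    by simp [insertTwo]⟩
  rw [mem_twoPlaces]
  refine ⟨height_le_iff.2 ?_, h5, by simp, ?_⟩
  · intro v hv
    rw [List.mem_append, List.mem_append] at hv
    rcases hv with h | h | h
    · exact ha' v h
    · exact hb' v h
    · exact hc' v h
  · rw [← pairwise_take_iff (by simp)]
    rwa [← List.append_assoc, ← List.length_append, List.take_left]

end InsertTwo

end Recursion

/-! ### The recursion for the rank-refined sums and its solution -/

section Counting

theorem sum_topMult_eq_one {S : Type*} [AddCommMonoid S] (f : List ℕ → S) (n : ℕ) :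
    ∑ l ∈ (avoiderLists (n + 1)).filter (fun l => topMult l = 1), f l =
      ∑ l ∈ avoiderLists n, ∑ s ∈ onePlaces (height l) (ascLen l), f (insertOne l s.1 s.2) := by
  rw [Finset.sum_sigma']
  symm
  refine Finset.sum_bij (fun s _ => insertOne s.1 s.2.1 s.2.2) ?_ ?_ ?_ (fun _ _ => rfl)
  · rintro ⟨l, M, i⟩ hs
    rw [Finset.mem_sigma, mem_avoiderLists] at hs
    obtain ⟨⟨rfl, hl⟩, hp⟩ := hs
    rw [Finset.mem_filter, mem_avoiderLists]
    refine ⟨⟨?_, isAvoider_insertOne hl hp⟩, topMult_insertOne (mem_onePlaces.1 hp).1⟩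
    simp only [insertOne, List.length_append, List.length_cons, List.length_take, List.length_drop]
    omega
  · rintro ⟨l, M, i⟩ hs ⟨l', M', i'⟩ hs' he
    obtain ⟨rfl, rfl, rfl⟩ :=
      insertOne_injective (Finset.mem_sigma.1 hs).2 (Finset.mem_sigma.1 hs').2 he
    rfl
  · intro l hl
    rw [Finset.mem_filter, mem_avoiderLists] at hl
    obtain ⟨l', M, i, h1, h2, h3, h4⟩ := exists_eq_insertOne hl.1.2 hl.2
    refine ⟨⟨l', M, i⟩, ?_, h4⟩
    rw [Finset.mem_sigma, mem_avoiderLists]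
    exact ⟨⟨by dsimp only; omega, h1⟩, h3⟩

theorem sum_topMult_ne_one {S : Type*} [AddCommMonoid S] (f : List ℕ → S) (n : ℕ) :
    ∑ l ∈ (avoiderLists (n + 2)).filter (fun l => ¬ topMult l = 1), f l =
      ∑ l ∈ avoiderLists n, ∑ s ∈ twoPlaces (height l) (ascLen l),
        f (insertTwo l s.1 s.2.1 s.2.2) := by
  rw [Finset.sum_sigma']
  symm
  refine Finset.sum_bij (fun s _ => insertTwo s.1 s.2.1 s.2.2.1 s.2.2.2) ?_ ?_ ?_ (fun _ _ => rfl)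
  · rintro ⟨l, M, i, j⟩ hs
    rw [Finset.mem_sigma, mem_avoiderLists] at hs
    obtain ⟨⟨rfl, hl⟩, hp⟩ := hs
    rw [Finset.mem_filter, mem_avoiderLists]
    refine ⟨⟨?_, isAvoider_insertTwo hl hp⟩, ?_⟩
    · simp only [insertTwo, List.length_append, List.length_cons, List.length_take,
        List.length_drop]
      omega
    · rw [topMult_insertTwo (mem_twoPlaces.1 hp).1]
      decide
  · rintro ⟨l, M, i, j⟩ hs ⟨l', M', i', j'⟩ hs' he
    obtain ⟨rfl, rfl, rfl, rfl⟩ :=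
      insertTwo_injective (Finset.mem_sigma.1 hs).2 (Finset.mem_sigma.1 hs').2 he
    rfl
  · intro l hl
    rw [Finset.mem_filter, mem_avoiderLists] at hl
    obtain ⟨l', M, i, j, h1, h2, h3, h4⟩ := exists_eq_insertTwo hl.1.2
      (by rintro rfl; simp at hl) hl.2
    refine ⟨⟨l', M, i, j⟩, ?_, h4⟩
    rw [Finset.mem_sigma, mem_avoiderLists]
    exact ⟨⟨by dsimp only; omega, h1⟩, h3⟩

theorem filter_topMult_ne_one_eq_empty :
    (avoiderLists 1).filter (fun l => ¬ topMult l = 1) = ∅ := by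
  rw [Finset.filter_eq_empty_iff]
  intro l hl
  rw [mem_avoiderLists] at hl
  obtain ⟨v, rfl⟩ := List.length_eq_one_iff.1 hl.1
  simp [topMult, height]

theorem avoiderLists_zero : avoiderLists 0 = {[]} := by
  ext l
  rw [mem_avoiderLists, List.length_eq_zero_iff, Finset.mem_singleton]
  refine ⟨fun h => h.1, fun h => ⟨h, ?_⟩⟩
  subst h
  exact ⟨by simp [IsInvList], by simp [Avoids102], by simp [Avoids000]⟩

theorem listRank_le_length (l : List ℕ) : listRank l ≤ l.length :=
  (Nat.sub_le _ _).trans (ascLen_le_length l)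

variable {S : Type*} [CommRing S] (y : S)

/-- The sum of `y ^ dist` over the avoiding sequences of length `n` and rank `r`. -/
def rankSum (n r : ℕ) : S :=
  ∑ l ∈ avoiderLists n, if listRank l = r then y ^ l.toFinset.card else 0

/-- Groups the avoiders by rank r + k. Ranks below r drop out because truncated subtraction gives `w
0`, and k ≤ n suffices because the rank is at most the length. -/
theorem sum_weight_listRank (w : ℕ → ℕ) (hw : w 0 = 0) (n r : ℕ) :
    ∑ l ∈ avoiderLists n, (w (listRank l + 1 - r) : S) * y ^ l.toFinset.card =
      ∑ k ∈ Finset.range (n + 1), (w (k + 1) : S) * rankSum y n (r + k) := by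
  simp only [rankSum, Finset.mul_sum]
  rw [Finset.sum_comm]
  refine Finset.sum_congr rfl fun l hl => ?_
  have hle := listRank_le_length l
  rw [(mem_avoiderLists.1 hl).1] at hle
  by_cases h : r ≤ listRank l
  · rw [Finset.sum_eq_single (listRank l - r)]
    · rw [if_pos (by omega)]
      congr 3
      omega
    · intro k _ hk
      rw [if_neg (by omega), mul_zero]
    · intro hk
      rw [Finset.mem_range] at hk
      omega
  · rw [show listRank l + 1 - r = 0 by omega, hw, Nat.cast_zero, zero_mul]
    symm
    apply Finset.sum_eq_zero
    intro k _
    rw [if_neg (by omega), mul_zero]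

theorem sum_onePlaces {l : List ℕ} (hl : IsAvoider l) (r : ℕ) :
    ∑ s ∈ onePlaces (height l) (ascLen l), (if listRank (insertOne l s.1 s.2) = r then
      y ^ (insertOne l s.1 s.2).toFinset.card else 0) =
      y * ((listRank l + 1 - r : ℕ) * y ^ l.toFinset.card) := by
  have : ∀ s ∈ onePlaces (height l) (ascLen l), (if listRank (insertOne l s.1 s.2) = r then
      y ^ (insertOne l s.1 s.2).toFinset.card else 0) =
      if s.2 - s.1 = r then y ^ (l.toFinset.card + 1) else 0 := by
    intro s hs
    rw [listRank_insertOne hs, card_toFinset_of_filter (mem_onePlaces.1 hs).1 (by simp [insertOne])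
      (filter_insertOne (mem_onePlaces.1 hs).1)]
  rw [Finset.sum_congr rfl this, ← Finset.sum_filter, Finset.sum_const,
    card_onePlaces_rank r hl.height_le_ascLen, nsmul_eq_mul, listRank]
  ring

theorem sum_twoPlaces {l : List ℕ} (hl : IsAvoider l) (r : ℕ) :
    ∑ s ∈ twoPlaces (height l) (ascLen l), (if listRank (insertTwo l s.1 s.2.1 s.2.2) = r then
      y ^ (insertTwo l s.1 s.2.1 s.2.2).toFinset.card else 0) =
      y * ((if r = 0 then 0 else (listRank l + 1 - (r - 1) : ℕ) * y ^ l.toFinset.card) +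
        ((listRank l + 1 - r).choose 2 : ℕ) * y ^ l.toFinset.card) := by
  have : ∀ s ∈ twoPlaces (height l) (ascLen l),
      (if listRank (insertTwo l s.1 s.2.1 s.2.2) = r then
      y ^ (insertTwo l s.1 s.2.1 s.2.2).toFinset.card else 0) =
      (if s.2.1 = s.2.2 ∧ s.2.1 + 1 - s.1 = r then y ^ (l.toFinset.card + 1) else 0) +
      (if s.2.1 < s.2.2 ∧ s.2.1 - s.1 = r then y ^ (l.toFinset.card + 1) else 0) := by
    intro s hs
    have hle := (mem_twoPlaces.1 hs).2.2.1
    rw [listRank_insertTwo hs, card_toFinset_of_filter (mem_twoPlaces.1 hs).1 (by simp [insertTwo])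
      (filter_insertTwo (mem_twoPlaces.1 hs).1)]
    by_cases h : s.2.1 = s.2.2
    · simp [h]
    · simp [h, lt_of_le_of_ne hle h]
  rw [Finset.sum_congr rfl this, Finset.sum_add_distrib, ← Finset.sum_filter, ← Finset.sum_filter,
    Finset.sum_const, Finset.sum_const, card_twoPlaces_eq_rank r hl.height_le_ascLen,
    card_twoPlaces_lt_rank r hl.height_le_ascLen, nsmul_eq_mul, nsmul_eq_mul, listRank]
  split_ifs
  · push_cast; ring
  · ring

theorem rankSum_zero (r : ℕ) : rankSum y 0 r = if r = 0 then 1 else 0 := by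
  simp [rankSum, avoiderLists_zero, listRank, ascLen, eq_comm]

theorem sum_single (n r : ℕ) : ∑ l ∈ (avoiderLists (n + 1)).filter (fun l => topMult l = 1),
      (if listRank l = r then y ^ l.toFinset.card else 0) =
    y * ∑ k ∈ Finset.range (n + 1), ((k + 1 : ℕ) : S) * rankSum y n (r + k) := by
  rw [sum_topMult_eq_one, ← sum_weight_listRank y (fun k => k) rfl, Finset.mul_sum]
  exact Finset.sum_congr rfl fun l hl => sum_onePlaces y (mem_avoiderLists.1 hl).2 r

theorem rankSum_one (r : ℕ) : rankSum y 1 r =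
    y * ∑ k ∈ Finset.range 1, ((k + 1 : ℕ) : S) * rankSum y 0 (r + k) := by
  rw [rankSum, ← Finset.sum_filter_add_sum_filter_not _ (fun l => topMult l = 1), sum_single,
    filter_topMult_ne_one_eq_empty, Finset.sum_empty, add_zero]

theorem rankSum_add_two (n r : ℕ) : rankSum y (n + 2) r =
    y * ∑ k ∈ Finset.range (n + 2), ((k + 1 : ℕ) : S) * rankSum y (n + 1) (r + k)
    + y * ((if r = 0 then 0 else
        ∑ k ∈ Finset.range (n + 1), ((k + 1 : ℕ) : S) * rankSum y n (r - 1 + k))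
      + ∑ k ∈ Finset.range (n + 1), ((k + 1).choose 2 : S) * rankSum y n (r + k)) := by
  rw [rankSum, ← Finset.sum_filter_add_sum_filter_not _ (fun l => topMult l = 1), sum_single]
  congr 1
  rw [sum_topMult_ne_one, ← sum_weight_listRank y (fun k => k) rfl,
    ← sum_weight_listRank y (fun k => k.choose 2) rfl,
    Finset.sum_congr rfl fun l hl => sum_twoPlaces y (mem_avoiderLists.1 hl).2 r,
    ← Finset.mul_sum, Finset.sum_add_distrib]
  split_ifs
  · simp
  · rfl

/-- The counts and the coefficients of A q^r obey the same recursion in n with the same initial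
values. -/
theorem rankSum_eq_sol (K : KernelSolution y) (n : ℕ) : ∀ r, rankSum y n r = K.sol n r := by
  induction n using Nat.strong_induction_on with
  | _ n ih =>
    intro r
    match n with
    | 0 => rw [rankSum_zero, K.sol_zero]
    | 1 =>
      rw [rankSum_one, K.sol_one]
      simp only [ih 0 (by omega)]
    | n + 2 =>
      rw [rankSum_add_two, K.sol_add_two]
      simp only [ih n (by omega), ih (n + 1) (by omega)]

open PowerSeries in
/-- The generating function of the avoiding sequences by length, with the number of distinct
entries and the rank marked by ring elements `y` and `z`. -/
def genFun (y z : S) : S⟦X⟧ :=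
  PowerSeries.mk fun n => ∑ l ∈ avoiderLists n, y ^ l.toFinset.card * z ^ listRank l

open PowerSeries in
-- The coefficient domain is left general: S = ℚ with y = z = 1 serves F, and S = ℚ⟦x,y,z⟧ serves E.
theorem eval_genFun_quartic [IsDomain S] (z : S) :
    (quartic X (C y) (C z)).eval (genFun y z) = 0 := by
  obtain ⟨K⟩ := nonempty_kernelSolution y
  refine K.eval_quartic_eq_zero z _ (K.one_sub_mul_eq_A z _ fun n => ?_)
  simp only [genFun, coeff_mk, ← rankSum_eq_sol, rankSum, Finset.mul_sum]
  rw [Finset.sum_comm]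
  refine Finset.sum_congr rfl fun l hl => ?_
  have hle := listRank_le_length l
  rw [(mem_avoiderLists.1 hl).1] at hle
  rw [Finset.sum_eq_single (listRank l)]
  · rw [if_pos rfl, mul_comm]
  · intro k _ hk
    rw [if_neg hk.symm, mul_zero]
  · intro hk
    rw [Finset.mem_range] at hk
    omega

end Counting

/-! ### Irreducibility by specialisation, and minimal polynomials -/

section Irreducibility

open Polynomial

/-- If the image of a factor is a unit, preservation of the degree makes that factor constant, and
it divides the constant term 1. -/
theorem irreducible_of_irreducible_map_of_natDegree_eq {R K : Type*} [CommRing R] [IsDomain R]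
    [CommRing K] [IsDomain K] (φ : R →+* K) {P : R[X]} (h0 : P.coeff 0 = 1)
    (hdeg : (P.map φ).natDegree = P.natDegree) (h : Irreducible (P.map φ)) : Irreducible P := by
  have hP : P ≠ 0 := by
    rintro rfl
    simp at h0
  have key : ∀ f g : R[X], P = f * g → IsUnit (f.map φ) → IsUnit f := by
    intro f g hfg hu
    have hf : f ≠ 0 := by rintro rfl; simp [hfg] at hP
    have hg : g ≠ 0 := by rintro rfl; simp [hfg] at hP
    have h1 : (f.map φ).natDegree = 0 := natDegree_eq_zero_of_isUnit hu
    have h2 : (P.map φ).natDegree ≤ g.natDegree := by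
      rw [hfg, Polynomial.map_mul]
      refine natDegree_mul_le.trans ?_
      rw [h1, zero_add]
      exact natDegree_map_le
    rw [hdeg, hfg, natDegree_mul hf hg] at h2
    have h3 : f = C (f.coeff 0) := eq_C_of_natDegree_eq_zero (by omega)
    rw [hfg, mul_coeff_zero] at h0
    rw [h3]
    exact (IsUnit.of_mul_eq_one _ h0).map C
  refine ⟨fun hu => h.not_isUnit (hu.map (mapRingHom φ)), fun f g hfg => ?_⟩
  have := h.isUnit_or_isUnit (by rw [hfg, Polynomial.map_mul])
  rcases this with hu | hu
  · exact Or.inl (key f g hfg hu)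
  · exact Or.inr (key g f (by rw [hfg, mul_comm]) hu)

theorem irreducible_quartic_zmod_two : Irreducible (X ^ 4 + X + 1 : (ZMod 2)[X]) := by
  have hdeg : (X ^ 4 + X + 1 : (ZMod 2)[X]).natDegree = 4 := by compute_degree!
  have hmon : (X ^ 4 + X + 1 : (ZMod 2)[X]).Monic := by monicity!
  have hne : (X ^ 4 + X + 1 : (ZMod 2)[X]) ≠ 1 := by
    intro h
    rw [h] at hdeg
    simp at hdeg
  rw [hmon.irreducible_iff_lt_natDegree_lt hne, hdeg]
  intro q hq hd hdvd
  rw [Finset.mem_Ioc] at hd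
  obtain hd1 | hd2 : q.natDegree = 1 ∨ q.natDegree = 2 := by omega
  · have hroot : q = X + C (q.coeff 0) := hq.eq_X_add_C hd1
    generalize q.coeff 0 = a at hroot
    subst hroot
    have h0 : (X ^ 4 + X + 1 : (ZMod 2)[X]).eval (-a) = 0 := by
      apply eval_eq_zero_of_dvd_of_eval_eq_zero hdvd
      rw [eval_add, eval_X, eval_C, neg_add_cancel]
    simp only [eval_add, eval_pow, eval_X, eval_one] at h0
    clear hq hd hdvd hd1
    revert a
    decide
  · have hform : q = X ^ 2 + C (q.coeff 1) * X + C (q.coeff 0) := by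
      have h2 : q.coeff 2 = 1 := by
        have := hq.coeff_natDegree
        rwa [hd2] at this
      conv_lhs => rw [q.as_sum_range' 3 (by omega)]
      simp only [Finset.sum_range_succ, Finset.sum_range_zero, ← C_mul_X_pow_eq_monomial, h2]
      simp
      ring
    generalize q.coeff 1 = a at hform
    generalize q.coeff 0 = b at hform
    -- The remainder of X⁴ + X + 1 on division by X² + aX + b; it vanishes for no a, b in the
    -- two-element field.
    have hrem : q ∣ C (2 * a * b - a ^ 3 + 1) * X + C (1 - b * (a ^ 2 - b)) := by
      have e : C (2 * a * b - a ^ 3 + 1) * X + C (1 - b * (a ^ 2 - b)) =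
          X ^ 4 + X + 1 - q * (X ^ 2 - C a * X + C (a ^ 2 - b)) := by
        rw [hform]
        simp only [map_add, map_sub, map_mul, map_pow, map_one, map_ofNat]
        ring
      rw [e]
      exact dvd_sub hdvd (dvd_mul_right _ _)
    have hz : C (2 * a * b - a ^ 3 + 1) * X + C (1 - b * (a ^ 2 - b)) = 0 := by
      apply eq_zero_of_dvd_of_natDegree_lt hrem
      rw [hd2]
      exact Nat.lt_succ_of_le natDegree_linear_le
    have h1 := congrArg (coeff · 1) hz
    have h0 := congrArg (coeff · 0) hz
    simp only [coeff_add, coeff_C_mul, coeff_X_one, coeff_C_succ, coeff_X_zero, coeff_C_zero,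
      coeff_zero, mul_one, mul_zero, add_zero, zero_add] at h0 h1
    clear hrem hz hform
    revert a b
    decide

theorem quartic_map {R S : Type*} [CommRing R] [CommRing S] (φ : R →+* S) (x y z : R) :
    (quartic x y z).map φ = quartic (φ x) (φ y) (φ z) := by
  simp [quartic, map_ofNat φ]

theorem testart_map {R S : Type*} [CommRing R] [CommRing S] (φ : R →+* S) (x : R) :
    (testart x).map φ = testart (φ x) := by
  simp [testart, map_ofNat φ]

theorem quartic_one_one {S : Type*} [CommRing S] (x : S) : quartic x 1 1 = testart x := by
  simp only [quartic, testart]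
  congr 1
  · congr 1
    · congr 1
      · congr 3
        ring
      · congr 2
        ring
    · congr 2
      ring
  · congr 2
    ring

theorem natDegree_quartic_le {S : Type*} [CommRing S] (x y z : S) :
    (quartic x y z).natDegree ≤ 4 := by
  unfold quartic
  compute_degree

theorem natDegree_testart_one {S : Type*} [CommRing S] [Nontrivial S] :
    (testart (1 : S)).natDegree = 4 := by
  unfold testart
  compute_degree!

theorem natDegree_testart_X : (testart (X : ℚ[X])).natDegree = 4 := by
  apply le_antisymm
  · rw [← quartic_one_one]
    exact natDegree_quartic_le _ _ _
  · have h : (testart (X : ℚ[X])).map (evalRingHom 1) = testart 1 := by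
      rw [testart_map]; simp
    rw [← natDegree_testart_one (S := ℚ), ← h]
    exact natDegree_map_le

theorem quarticE_map_substOne : quarticE.map substOne = testart (X : ℚ[X]) := by
  rw [quarticE, quartic_map, ← quartic_one_one]
  simp [substOne]

theorem natDegree_quarticE : quarticE.natDegree = 4 := by
  apply le_antisymm
  · exact natDegree_quartic_le _ _ _
  · rw [← natDegree_testart_X, ← quarticE_map_substOne]
    exact natDegree_map_le

theorem coeff_zero_quartic {S : Type*} [CommRing S] (x y z : S) :
    (quartic x y z).coeff 0 = 1 := by
  simp [quartic]

theorem irreducible_testart_one : Irreducible (testart (1 : ℚ)) := by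
  have h2 : (testart (1 : ℤ)).map (Int.castRingHom (ZMod 2)) = X ^ 4 + X + 1 := by
    rw [testart_map, map_one, testart]
    have e1 : (1 - 2 * 1 + 2 * 1 ^ 2 : ZMod 2) = -1 := by decide
    have e2 : (1 * (-1 + 4 * 1 - 2 * 1 ^ 2 + 1 ^ 3) : ZMod 2) = 0 := by decide
    rw [e1, e2]
    simp only [map_neg, map_one, map_zero, sub_self, mul_zero, one_pow, zero_mul, add_zero]
    ring
  have hℤ : Irreducible (testart (1 : ℤ)) := by
    apply irreducible_of_irreducible_map_of_natDegree_eq (Int.castRingHom (ZMod 2))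
    · rw [← quartic_one_one, coeff_zero_quartic]
    · rw [testart_map, map_one, natDegree_testart_one, natDegree_testart_one]
    · rw [h2]
      exact irreducible_quartic_zmod_two
  -- Reduction modulo 2 settles the integer polynomial; Gauss's lemma carries the result to ℚ.
  have h := (IsPrimitive.Int.irreducible_iff_irreducible_map_cast (hℤ.isPrimitive
    (by rw [natDegree_testart_one]; decide))).1 hℤ
  rwa [testart_map, map_one] at h

theorem irreducible_testart : Irreducible (testart (X : ℚ[X])) := by
  have h : (testart (X : ℚ[X])).map (evalRingHom 1) = testart 1 := by
    rw [testart_map]; simp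
  apply irreducible_of_irreducible_map_of_natDegree_eq (evalRingHom (1 : ℚ))
  · rw [← quartic_one_one, coeff_zero_quartic]
  · rw [h, natDegree_testart_X, natDegree_testart_one]
  · rw [h]
    exact irreducible_testart_one

theorem irreducible_quarticE : Irreducible quarticE := by
  apply irreducible_of_irreducible_map_of_natDegree_eq substOne
  · exact coeff_zero_quartic _ _ _
  · rw [quarticE_map_substOne, natDegree_testart_X, natDegree_quarticE]
  · rw [quarticE_map_substOne]
    exact irreducible_testart

theorem isMinimalPolynomial_of_irreducible {R A : Type*} [CommRing R] [IsDomain R]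
    [UniqueFactorizationMonoid R] [CommRing A] [IsDomain A] [Algebra R A] [FaithfulSMul R A]
    {P : R[X]} {a : A} (hP : Irreducible P) (hdeg : P.natDegree ≠ 0) (ha : aeval a P = 0) :
    IsMinimalPolynomial P a := by
  let : Algebra (FractionRing R) (FractionRing A) := FractionRing.liftAlgebra R (FractionRing A)
  refine ⟨hP, ?_⟩
  have hirr : Irreducible (P.map (algebraMap R (FractionRing R))) :=
    (hP.isPrimitive hdeg).irreducible_iff_irreducible_map_fraction_map.1 hP
  have hroot : aeval (algebraMap A (FractionRing A) a) (P.map (algebraMap R (FractionRing R))) =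
      0 := by
    rw [aeval_map_algebraMap, aeval_algebraMap_apply, ha, map_zero]
  have h := minpoly.Irreducible.eq_minpoly hirr hroot
  rwa [leadingCoeff_map_of_injective (IsFractionRing.injective R (FractionRing R))] at h

end Irreducibility

/-! ### From the general generating function to E and F -/

section Assembly

theorem count_eq_card_filter (n m t : ℕ) :
    count n m t =
      ((avoiderLists n).filter fun l => l.toFinset.card = m ∧ listRank l = t).card := by
  rw [avoiderLists, Finset.filter_map, Finset.card_map, count]
  congr 1
  refine Finset.filter_congr fun e he => ?_
  simp only [Function.comp_apply, Function.Embedding.coeFn_mk]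
  rw [rank_eq_listRank he, dist_eq_card_toFinset, Nat.cast_inj]

theorem card_avoiderLists (n : ℕ) : (avoiderLists n).card = (avoiders n).card :=
  Finset.card_map _

theorem genFun_one_one : genFun (1 : ℚ) 1 = F := by
  ext n
  simp [genFun, F, card_avoiderLists]

theorem aeval_F_testart : Polynomial.aeval F (testart (Polynomial.X : Polynomial ℚ)) = 0 := by
  have h := eval_genFun_quartic (1 : ℚ) 1
  rw [genFun_one_one, map_one, quartic_one_one] at h
  rw [Polynomial.aeval_def, ← Polynomial.eval_map, testart_map]
  simpa [PowerSeries.algebraMap_apply'] using h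

/-- The part of `E` of degree less than `N` in the first variable. -/
noncomputable def truncE (N : ℕ) : MvPowerSeries (Fin 3) ℚ :=
  ∑ n ∈ Finset.range N, ∑ l ∈ avoiderLists n,
    MvPowerSeries.X 1 ^ l.toFinset.card * MvPowerSeries.X 2 ^ listRank l * MvPowerSeries.X 0 ^ n

theorem coeff_monomial_three (d : Fin 3 →₀ ℕ) (a b c : ℕ) :
    MvPowerSeries.coeff d (MvPowerSeries.X 1 ^ b * MvPowerSeries.X 2 ^ c * MvPowerSeries.X 0 ^ a :
      MvPowerSeries (Fin 3) ℚ) = if d 0 = a ∧ b = d 1 ∧ c = d 2 then 1 else 0 := by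
  rw [MvPowerSeries.X_pow_eq, MvPowerSeries.X_pow_eq, MvPowerSeries.X_pow_eq,
    MvPowerSeries.monomial_mul_monomial, MvPowerSeries.monomial_mul_monomial,
    MvPowerSeries.coeff_monomial]
  have : (d = Finsupp.single 1 b + Finsupp.single 2 c + Finsupp.single 0 a) ↔
      (d 0 = a ∧ b = d 1 ∧ c = d 2) := by
    rw [Finsupp.ext_iff]
    simp [Fin.forall_fin_succ, Finsupp.single_apply, eq_comm]
  simp only [this, mul_one]

theorem X_pow_dvd_E_sub_truncE (N : ℕ) : MvPowerSeries.X 0 ^ N ∣ E - truncE N := by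
  rw [MvPowerSeries.X_pow_dvd_iff]
  intro d hd
  rw [map_sub, sub_eq_zero, truncE]
  simp only [map_sum, coeff_monomial_three]
  rw [Finset.sum_eq_single (d 0)]
  · simp only [true_and, Finset.sum_boole]
    rw [← count_eq_card_filter]
    rfl
  · intro n _ hn
    apply Finset.sum_eq_zero
    intro l _
    rw [if_neg]
    exact fun h => hn h.1.symm
  · intro h
    exact absurd (Finset.mem_range.2 hd) h

/-- The equation for `genFun` has an auxiliary series variable that must become x. Modulo its N-th
power everything is a polynomial in that variable, so the replacement is an evaluation homomorphism.
-/
theorem X_pow_dvd_eval_truncE (N : ℕ) :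
    MvPowerSeries.X 0 ^ N ∣ (quartic (MvPowerSeries.X 0 : MvPowerSeries (Fin 3) ℚ)
      (MvPowerSeries.X 1) (MvPowerSeries.X 2)).eval (truncE N) := by
  set y : MvPowerSeries (Fin 3) ℚ := MvPowerSeries.X 1
  set z : MvPowerSeries (Fin 3) ℚ := MvPowerSeries.X 2
  set G := genFun y z with hG
  set p : Polynomial (MvPowerSeries (Fin 3) ℚ) := PowerSeries.trunc N G with hp
  set Q : Polynomial (MvPowerSeries (Fin 3) ℚ) :=
    (quartic Polynomial.X (Polynomial.C y) (Polynomial.C z)).eval p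
  have h1 : (PowerSeries.X : PowerSeries (MvPowerSeries (Fin 3) ℚ)) ^ N ∣ G - p := by
    rw [PowerSeries.X_pow_dvd_iff]
    intro m hm
    rw [map_sub, Polynomial.coeff_coe, hp, PowerSeries.coeff_trunc, if_pos hm, sub_self]
  have h2 : ((Q : Polynomial (MvPowerSeries (Fin 3) ℚ)) : PowerSeries (MvPowerSeries (Fin 3) ℚ)) =
      (quartic PowerSeries.X (PowerSeries.C y) (PowerSeries.C z)).eval
        (p : PowerSeries (MvPowerSeries (Fin 3) ℚ)) := by
    have := Polynomial.hom_eval₂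
      (quartic Polynomial.X (Polynomial.C y) (Polynomial.C z)) (RingHom.id _)
      (Polynomial.coeToPowerSeries.ringHom (R := MvPowerSeries (Fin 3) ℚ)) p
    rw [Polynomial.eval₂_id, RingHom.comp_id, ← Polynomial.eval_map, quartic_map] at this
    simpa using this
  have h3 : (PowerSeries.X : PowerSeries (MvPowerSeries (Fin 3) ℚ)) ^ N ∣
      (Q : PowerSeries (MvPowerSeries (Fin 3) ℚ)) := by
    have h := h1.trans (Polynomial.sub_dvd_eval_sub G p
      (quartic PowerSeries.X (PowerSeries.C y) (PowerSeries.C z)))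
    rw [hG, eval_genFun_quartic, zero_sub, dvd_neg, ← h2] at h
    exact h
  have h4 : Polynomial.X ^ N ∣ Q := by
    rw [Polynomial.X_pow_dvd_iff]
    intro m hm
    rw [← Polynomial.coeff_coe]
    exact PowerSeries.X_pow_dvd_iff.1 h3 m hm
  have h5 := map_dvd (Polynomial.evalRingHom (MvPowerSeries.X 0 : MvPowerSeries (Fin 3) ℚ)) h4
  have h6 : Polynomial.evalRingHom (MvPowerSeries.X 0 : MvPowerSeries (Fin 3) ℚ) p = truncE N := by
    rw [hp, PowerSeries.trunc_apply, truncE, map_sum, Nat.Ico_zero_eq_range]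
    refine Finset.sum_congr rfl fun n _ => ?_
    rw [Polynomial.coe_evalRingHom, Polynomial.eval_monomial, hG, genFun, PowerSeries.coeff_mk,
      Finset.sum_mul]
  have h7 : Polynomial.evalRingHom (MvPowerSeries.X 0 : MvPowerSeries (Fin 3) ℚ) Q =
      (quartic (MvPowerSeries.X 0) y z).eval (truncE N) := by
    have := Polynomial.hom_eval₂
      (quartic Polynomial.X (Polynomial.C y) (Polynomial.C z)) (RingHom.id _)
      (Polynomial.evalRingHom (MvPowerSeries.X 0 : MvPowerSeries (Fin 3) ℚ)) p
    rw [Polynomial.eval₂_id, RingHom.comp_id, ← Polynomial.eval_map, quartic_map, h6] at this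
    simpa using this
  rw [h7] at h5
  simpa using h5

theorem aeval_E_quarticE : Polynomial.aeval E quarticE = 0 := by
  rw [Polynomial.aeval_def, ← Polynomial.eval_map, quarticE, quartic_map]
  simp only [MvPowerSeries.algebraMap_apply', MvPolynomial.coe_X]
  have h : ∀ N, MvPowerSeries.X 0 ^ N ∣ (quartic (MvPowerSeries.X 0 : MvPowerSeries (Fin 3) ℚ)
      (MvPowerSeries.X 1) (MvPowerSeries.X 2)).eval E := by
    intro N
    have h1 := (X_pow_dvd_E_sub_truncE N).trans (Polynomial.sub_dvd_eval_sub E (truncE N)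
      (quartic (MvPowerSeries.X 0 : MvPowerSeries (Fin 3) ℚ)
        (MvPowerSeries.X 1) (MvPowerSeries.X 2)))
    have h2 := dvd_add h1 (X_pow_dvd_eval_truncE N)
    rwa [sub_add_cancel] at h2
  have h0 : (quartic (MvPowerSeries.X 0 : MvPowerSeries (Fin 3) ℚ)
      (MvPowerSeries.X 1) (MvPowerSeries.X 2)).eval E = 0 := by
    ext d
    exact MvPowerSeries.X_pow_dvd_iff.1 (h (d 0 + 1)) d (Nat.lt_succ_self _)
  simpa using h0

/-- The statistics of the avoiding sequences of length `n`. -/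
def statPairs (n : ℕ) : Finset (ℕ × ℕ) :=
  (avoiderLists n).image fun l => (l.toFinset.card, listRank l)

theorem mem_statPairs_of_count_ne_zero {n : ℕ} {p : ℕ × ℕ} (h : count n p.1 p.2 ≠ 0) :
    p ∈ statPairs n := by
  rw [count_eq_card_filter, Finset.card_ne_zero] at h
  obtain ⟨l, hl⟩ := h
  rw [Finset.mem_filter] at hl
  exact Finset.mem_image.2 ⟨l, hl.1, Prod.ext hl.2.1 hl.2.2⟩

theorem finite_count_ne_zero (n : ℕ) : {p : ℕ × ℕ | count n p.1 p.2 ≠ 0}.Finite :=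
  (statPairs n).finite_toSet.subset fun _ h => mem_statPairs_of_count_ne_zero h

theorem finsum_coeff_E (n : ℕ) :
    ∑ᶠ p : ℕ × ℕ, MvPowerSeries.coeff (Finsupp.equivFunOnFinite.symm ![n, p.1, p.2]) E =
      PowerSeries.coeff n F := by
  have h : ∀ p : ℕ × ℕ, MvPowerSeries.coeff (Finsupp.equivFunOnFinite.symm ![n, p.1, p.2]) E =
      (count n p.1 p.2 : ℚ) := fun p => rfl
  simp only [h]
  rw [finsum_eq_sum_of_support_subset (s := statPairs n)]
  -- The avoiders of length n are partitioned into the fibres of the pair (dist, rank).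
  · rw [F, PowerSeries.coeff_mk, ← card_avoiderLists, statPairs,
      Finset.card_eq_sum_card_image (fun l : List ℕ => (l.toFinset.card, listRank l))]
    push_cast
    refine Finset.sum_congr rfl fun p _ => ?_
    rw [count_eq_card_filter]
    simp only [Prod.ext_iff]
  · intro p hp
    exact mem_statPairs_of_count_ne_zero (by simpa using hp)

end Assembly

end InvSeq

theorem mainTheorem1 :
    -- `E(x, y, z)` is algebraic, with minimal polynomial the explicit quartic
    (IsAlgebraic (MvPolynomial (Fin 3) ℚ) InvSeq.E ∧
      Polynomial.aeval InvSeq.E InvSeq.quarticE = 0 ∧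
      InvSeq.quarticE.natDegree = 4 ∧
      InvSeq.IsMinimalPolynomial InvSeq.quarticE InvSeq.E) ∧
    -- `E(x, 1, 1)` is well defined (finite sums) and equal to `F(x)`
    (∀ n : ℕ, {p : ℕ × ℕ | InvSeq.count n p.1 p.2 ≠ 0}.Finite ∧
      ∑ᶠ p : ℕ × ℕ, MvPowerSeries.coeff (Finsupp.equivFunOnFinite.symm ![n, p.1, p.2]) InvSeq.E =
        PowerSeries.coeff n InvSeq.F) ∧
    -- `y = z = 1` turns the quartic into Testart's polynomial, the minimal polynomial of `F(x)`
    InvSeq.quarticE.map InvSeq.substOne = InvSeq.testart (Polynomial.X : Polynomial ℚ) ∧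
    Polynomial.aeval InvSeq.F (InvSeq.testart (Polynomial.X : Polynomial ℚ)) = 0 ∧
    InvSeq.IsMinimalPolynomial (InvSeq.testart (Polynomial.X : Polynomial ℚ)) InvSeq.F := by
  refine ⟨⟨⟨InvSeq.quarticE, InvSeq.irreducible_quarticE.ne_zero, InvSeq.aeval_E_quarticE⟩,
    InvSeq.aeval_E_quarticE, InvSeq.natDegree_quarticE, ?_⟩,
    fun n => ⟨InvSeq.finite_count_ne_zero n, InvSeq.finsum_coeff_E n⟩,
    InvSeq.quarticE_map_substOne, InvSeq.aeval_F_testart, ?_⟩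
  · exact InvSeq.isMinimalPolynomial_of_irreducible InvSeq.irreducible_quarticE
      (by rw [InvSeq.natDegree_quarticE]; decide) InvSeq.aeval_E_quarticE
  · exact InvSeq.isMinimalPolynomial_of_irreducible InvSeq.irreducible_testart
      (by rw [InvSeq.natDegree_testart_X]; decide) InvSeq.aeval_F_testart
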